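/- Let $\Bbbk$ be an algebraically closed field of characteristic $0$, and let $\mathbb{P}^1$ be the projective line over $\Bbbk$; automorphisms are automorphisms of algebraic varieties over $\Bbbk$. Then the following assertions hold. (i) Let $G\subset\operatorname{Aut}(\mathbb{P}^1)$ be a finite subgroup. Then there exists an abelian subgroup $A\subset G$ of index at most $12$ acting on $\mathbb{P}^1$ with a fixed point, that is, some point of $\mathbb{P}^1$ is fixed by every element of $A$. (ii) Let $G\subset\operatorname{Aut}(\mathbb{P}^1\times\mathbb{P}^1)$ be a finite subgroup. Then there exists an abelian subgroup $A\subset G$ of index at most $288$ that acts on $\mathbb{P}^1\times\mathbb{P}^1$ with a fixed point and does not interchange the rulings of $\mathbb{P}^1\times\mathbb{P}^1$, that is, every element of $A$ maps each line $\{a\}\times\mathbb{P}^1$ to a line of the form $\{a'\}\times\mathbb{P}^1$ and each line $\mathbb{P}^1\times\{b\}$ to a line of the form $\mathbb{P}^1\times\{b'\}$. (iii) The group $\operatorname{Aut}(\mathbb{P}^1\times\mathbb{P}^1)$ is Jordan (that is, for some constant $J$, each of its finite subgroups has a normal abelian subgroup of index at most $J$), and its weak Jordan constant is $$\bar{J}\big(\operatorname{Aut}(\mathbb{P}^1\times\mathbb{P}^1)\big)=288.$$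 Here the weak Jordan constant $\bar{J}(\Gamma)$ of a Jordan group $\Gamma$ is the minimal number $\bar{J}$ such that every finite subgroup $G\subset\Gamma$ contains a (not necessarily normal) abelian subgroup of index at most $\bar{J}$. -/

import Mathlib

/-! ### Varieties given by multihomogeneous coordinates

A point of a product of projective spaces has coordinates `c x : σ → k`, defined up to rescaling each
group of variables. The weight `w : σ → M` records the multidegree of each variable. Vanishing of a
multihomogeneous polynomial, and the value of a quotient of two such polynomials of the same
multidegree, do not depend on the chosen representatives of the coordinates. -/

open scoped Topology

namespace ProjVar

variable {k : Type*} [Field k] {X σ M : Type*} [AddCommMonoid M]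

/-- The Zariski topology: the sets `{x | F x ≠ 0}` with `F` multihomogeneous generate the open sets
(equivalently, the closed sets are the common zero loci of multihomogeneous polynomials). -/
@[reducible] def zariskiTopology (w : σ → M) (c : X → σ → k) : TopologicalSpace X :=
  TopologicalSpace.generateFrom
    {U | ∃ (F : MvPolynomial σ k) (d : M), F.IsWeightedHomogeneous w d ∧
      U = {x | MvPolynomial.eval (c x) F ≠ 0}}

/-- `f` is a regular function on `U`: every point of `U` has an open neighbourhood `V` in `U` on
which `f` is a quotient `F / G` of multihomogeneous polynomials of the same multidegree, where `G`
has no zero on `V`. (Only the values of `f` on `U` matter.) -/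
def IsRegularOn (w : σ → M) (c : X → σ → k) (U : Set X) (f : X → k) : Prop :=
  ∀ x ∈ U, ∃ V : Set X, IsOpen[zariskiTopology w c] V ∧ x ∈ V ∧ V ⊆ U ∧
    ∃ (F G : MvPolynomial σ k) (d : M),
      F.IsWeightedHomogeneous w d ∧ G.IsWeightedHomogeneous w d ∧
      ∀ y ∈ V, MvPolynomial.eval (c y) G ≠ 0 ∧
        f y = MvPolynomial.eval (c y) F / MvPolynomial.eval (c y) G

/-- `φ` is a morphism of varieties from `X` to itself: it is continuous and the pullback of every
regular function on an open set `V` is regular on the preimage of `V`. -/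
def IsMorphism (w : σ → M) (c : X → σ → k) (φ : X → X) : Prop :=
  ∀ V : Set X, IsOpen[zariskiTopology w c] V →
    IsOpen[zariskiTopology w c] (φ ⁻¹' V) ∧
    ∀ f : X → k, IsRegularOn w c V f → IsRegularOn w c (φ ⁻¹' V) (f ∘ φ)

theorem isMorphism_id (w : σ → M) (c : X → σ → k) : IsMorphism w c id :=
  fun _ hV => ⟨hV, fun _ hf => hf⟩

theorem IsMorphism.comp {w : σ → M} {c : X → σ → k} {φ ψ : X → X}
    (hφ : IsMorphism w c φ) (hψ : IsMorphism w c ψ) : IsMorphism w c (φ ∘ ψ) :=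
  fun V hV => ⟨(hψ _ (hφ V hV).1).1, fun f hf => (hψ _ (hφ V hV).1).2 _ ((hφ V hV).2 f hf)⟩

/-- The automorphism group of the variety: bijections `φ` such that `φ` and its inverse are
morphisms. -/
def autGroup (w : σ → M) (c : X → σ → k) : Subgroup (Equiv.Perm X) where
  carrier := {φ | IsMorphism w c φ ∧ IsMorphism w c φ.symm}
  one_mem' := ⟨isMorphism_id w c, isMorphism_id w c⟩
  mul_mem' := fun ha hb => ⟨ha.1.comp hb.1, hb.2.comp ha.2⟩
  inv_mem' := fun ha => ⟨ha.2, ha.1⟩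

end ProjVar

/-- The projective line over `k`, as the set of lines through the origin in `k²`. -/
abbrev P1 (k : Type*) [Field k] : Type _ := Projectivization k (Fin 2 → k)

/-- Homogeneous coordinates on the projective line. -/
noncomputable def P1.coords (k : Type*) [Field k] (p : P1 k) : Fin 2 → k := p.rep

/-- Both variables on the projective line have degree `1`. -/
def P1.weight : Fin 2 → ℕ := fun _ => 1

/-- The automorphism group of the variety `ℙ¹`. -/
noncomputable abbrev P1.Aut (k : Type*) [Field k] : Subgroup (Equiv.Perm (P1 k)) :=
  ProjVar.autGroup P1.weight (P1.coords k)

/-- The points of `ℙ¹ × ℙ¹`. -/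
abbrev P1xP1 (k : Type*) [Field k] : Type _ := P1 k × P1 k

/-- Bihomogeneous coordinates on `ℙ¹ × ℙ¹`: two for each factor. -/
noncomputable def P1xP1.coords (k : Type*) [Field k] (x : P1xP1 k) : Fin 2 ⊕ Fin 2 → k :=
  Sum.elim x.1.rep x.2.rep

/-- The variables of the first factor have bidegree `(1, 0)`, those of the second one `(0, 1)`. -/
def P1xP1.weight : Fin 2 ⊕ Fin 2 → ℕ × ℕ := Sum.elim (fun _ => (1, 0)) (fun _ => (0, 1))

/-- The automorphism group of the variety `ℙ¹ × ℙ¹`. -/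
noncomputable abbrev P1xP1.Aut (k : Type*) [Field k] : Subgroup (Equiv.Perm (P1xP1 k)) :=
  ProjVar.autGroup P1xP1.weight (P1xP1.coords k)

/-- The ruling of `ℙ¹ × ℙ¹` by the lines `{a} × ℙ¹`. -/
def P1xP1.firstRuling (k : Type*) [Field k] : Set (Set (P1xP1 k)) :=
  {L | ∃ a : P1 k, L = {x | x.1 = a}}

/-- The ruling of `ℙ¹ × ℙ¹` by the lines `ℙ¹ × {b}`. -/
def P1xP1.secondRuling (k : Type*) [Field k] : Set (Set (P1xP1 k)) :=
  {L | ∃ b : P1 k, L = {x | x.2 = b}}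

/-- `φ` does not interchange the two rulings: it maps every line of either ruling to a line of the
same ruling. -/
def P1xP1.PreservesRulings {k : Type*} [Field k] (φ : Equiv.Perm (P1xP1 k)) : Prop :=
  (∀ L ∈ P1xP1.firstRuling k, φ '' L ∈ P1xP1.firstRuling k) ∧
  (∀ L ∈ P1xP1.secondRuling k, φ '' L ∈ P1xP1.secondRuling k)

/-- `J` bounds the index of some normal abelian subgroup in every finite subgroup of `Γ`. -/
def IsJordanBound (Γ : Type*) [Group Γ] (J : ℕ) : Prop :=
  ∀ G : Subgroup Γ, Finite G →
    ∃ A : Subgroup G, A.Normal ∧ (∀ a ∈ A, ∀ b ∈ A, a * b = b * a) ∧ A.index ≤ J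

/-- `J` bounds the index of some (not necessarily normal) abelian subgroup in every finite subgroup
of `Γ`. -/
def IsWeakJordanBound (Γ : Type*) [Group Γ] (J : ℕ) : Prop :=
  ∀ G : Subgroup Γ, Finite G →
    ∃ A : Subgroup G, (∀ a ∈ A, ∀ b ∈ A, a * b = b * a) ∧ A.index ≤ J

/-- `Γ` is a Jordan group. -/
def IsJordanGroup (Γ : Type*) [Group Γ] : Prop := ∃ J : ℕ, IsJordanBound Γ J

/-- `Γ` is a Jordan group whose weak Jordan constant is `J`. -/
def HasWeakJordanConstant (Γ : Type*) [Group Γ] (J : ℕ) : Prop :=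
  IsJordanGroup Γ ∧ IsLeast {J' : ℕ | IsWeakJordanBound Γ J'} J

/-! Automorphisms are linear up to interchanging factors. A morphism to `ℙ¹` is locally a pair of
forms of equal degree. Polynomial rings are factorial, so the local pairs are multiples of one
coprime pair, which has no common zero (`ProjVar.IsLocallyForms.exists_isForms`). On `ℙ¹`, a
bijection normalized to fix `0` and `∞` is `t ↦ c t ^ a`, and injectivity gives `a = 1` in
characteristic zero (`P1.aut_le_PL`). On `ℙ¹ × ℙ¹`, two forms of the same bidegree with both entries
positive have a common zero, by resultants, so each component of an automorphism depends on one
coordinate only (`P1xP1.exists_of_mem_aut`).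

Upper bounds. A nontrivial projectivity of finite order is diagonalizable and has exactly two fixed
points (`P1.ncard_fixedPoints`). Burnside's count on the points with nontrivial stabilizer then
leaves no finite group all of whose orbits have at least `13` points
(`exists_ncard_orbit_le_twelve`); the classification of finite subgroups is not needed. A point
stabilizer in a finite group is abelian: commutators in it are unipotent of finite order, hence
trivial (`P1.mul_comm_of_fixed`). This gives index `12` on `ℙ¹`. On the product, the elements
preserving the factors form a subgroup of index at most `2`, and short orbits of its two projections
give `2 * 12 * 12 = 288`. Passing to normal cores shows that the group is Jordan.

Lower bound. The alternating group on five letters acts faithfully on `ℙ¹`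
(`P1.exists_alternatingGroup_hom`), so its wreath product with the group of order two, of order
`7200`, acts on `ℙ¹ × ℙ¹`. Abelian subgroups of the former have order at most `5`, those of the
latter at most `25`, and `7200 / 25 = 288` (`IsWeakJordanBound.le_of_wreath`).

The embedding comes from five matrices that form a regular simplex for the determinant form on
2-by-2 matrices. An even permutation of them is induced by `x ↦ a x b`, and it determines `a` up to
a scalar. -/

namespace MvPolynomial

/-! ### Weighted homogeneous polynomials: scaling, substitution, factors -/

section Homogeneous

variable {k σ τ M M' : Type*} [CommSemiring k] [AddCommMonoid M] [AddCommMonoid M']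
  {w : σ → M} {F : MvPolynomial σ k} {d : M}

/-- Stated for a character of the grading monoid, so that it covers both the single scaling on `ℙ¹`
and the independent scalings of the two factors of `ℙ¹ × ℙ¹`. -/
theorem IsWeightedHomogeneous.eval_smul (hF : F.IsWeightedHomogeneous w d)
    (χ : Multiplicative M →* k) (v : σ → k) :
    eval (fun s => χ (.ofAdd (w s)) * v s) F = χ (.ofAdd d) * eval v F := by
  rw [eval_eq, eval_eq, Finset.mul_sum]
  refine Finset.sum_congr rfl fun m hm => ?_
  have h : Finsupp.weight w m = d := hF (mem_support_iff.mp hm)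
  rw [Finsupp.weight_apply, Finsupp.sum] at h
  have h' : χ (.ofAdd d) = ∏ s ∈ m.support, χ (.ofAdd (w s)) ^ m s := by
    rw [← h, ofAdd_sum, map_prod]
    exact Finset.prod_congr rfl fun s _ => by rw [ofAdd_nsmul, map_pow]
  simp only [mul_pow, Finset.prod_mul_distrib]
  rw [h']
  ring

theorem IsWeightedHomogeneous.aeval (hF : F.IsWeightedHomogeneous w d) {w' : τ → M'}
    (f : M →+ M') (P : σ → MvPolynomial τ k) (hP : ∀ s, (P s).IsWeightedHomogeneous w' (f (w s))) :
    (MvPolynomial.aeval P F).IsWeightedHomogeneous w' (f d) := by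
  rw [aeval_def, eval₂_eq]
  refine IsWeightedHomogeneous.sum _ _ _ fun m hm => ?_
  have h : Finsupp.weight w m = d := hF (mem_support_iff.mp hm)
  rw [algebraMap_eq]
  refine IsWeightedHomogeneous.C_mul ?_ _
  have h' : f d = ∑ s ∈ m.support, m s • f (w s) := by
    rw [← h, Finsupp.weight_apply, Finsupp.sum, map_sum]
    simp only [map_nsmul]
  rw [h']
  exact IsWeightedHomogeneous.prod _ _ _ fun s _ => (hP s).pow _

theorem IsWeightedHomogeneous.map_weight (hF : F.IsWeightedHomogeneous w d) (f : M →+ M') :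
    F.IsWeightedHomogeneous (fun s => f (w s)) (f d) := by
  intro m hm
  rw [← hF hm, Finsupp.weight_apply, Finsupp.weight_apply, Finsupp.sum, Finsupp.sum, map_sum]
  simp only [map_nsmul]

end Homogeneous

section Factors

variable {k σ : Type*} [CommRing k]

/-- The substitution `X s ↦ X s * T ^ w s`, with `T` the variable of the outer polynomial ring. -/
noncomputable def gradingHom (w : σ → ℕ) : MvPolynomial σ k →ₐ[k] Polynomial (MvPolynomial σ k) :=
  aeval fun s => Polynomial.monomial (w s) (X s)

theorem gradingHom_monomial (w : σ → ℕ) (m : σ →₀ ℕ) (r : k) :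
    gradingHom w (monomial m r) = Polynomial.monomial (Finsupp.weight w m) (monomial m r) := by
  rw [gradingHom, aeval_monomial, Finsupp.weight_apply, ← Polynomial.C_mul_X_pow_eq_monomial,
    monomial_eq]
  simp only [← Polynomial.C_mul_X_pow_eq_monomial, Finsupp.prod, Finsupp.sum, mul_pow,
    Finset.prod_mul_distrib, map_mul, map_prod, map_pow, smul_eq_mul, ← pow_mul,
    Finset.prod_pow_eq_pow_sum, mul_comm (w _)]
  rw [mul_assoc]
  rfl

theorem coeff_coeff_gradingHom (w : σ → ℕ) (F : MvPolynomial σ k) (n : ℕ) (m : σ →₀ ℕ) :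
    coeff m ((gradingHom w F).coeff n) = if Finsupp.weight w m = n then coeff m F else 0 := by
  induction F using MvPolynomial.induction_on' with
  | monomial m' r =>
    classical
    rw [gradingHom_monomial, Polynomial.coeff_monomial]
    by_cases h : m' = m
    · subst h
      split_ifs <;> simp
    · split_ifs <;> simp [h]
  | add p q hp hq =>
    rw [map_add, Polynomial.coeff_add, coeff_add, hp, hq, coeff_add]
    split_ifs <;> simp

/-- `gradingHom` places the component of weight `n` in `T`-degree `n`, so homogeneity becomes a
question about degrees in `T`. -/
theorem isWeightedHomogeneous_iff_gradingHom (w : σ → ℕ) (F : MvPolynomial σ k) (d : ℕ) :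
    F.IsWeightedHomogeneous w d ↔ ∀ n, n ≠ d → (gradingHom w F).coeff n = 0 := by
  constructor
  · intro h n hn
    ext m
    rw [coeff_coeff_gradingHom, coeff_zero]
    split_ifs with h'
    · by_contra h0
      exact hn (h'.symm.trans (h h0))
    · rfl
  · intro h m hm
    by_contra hne
    have := congrArg (coeff m) (h _ hne)
    rw [coeff_coeff_gradingHom, if_pos rfl, coeff_zero] at this
    exact hm this

theorem gradingHom_ne_zero (w : σ → ℕ) {F : MvPolynomial σ k} (hF : F ≠ 0) :
    gradingHom w F ≠ 0 := by
  obtain ⟨m, hm⟩ := ne_zero_iff.mp hF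
  intro h
  have := coeff_coeff_gradingHom w F (Finsupp.weight w m) m
  rw [h, if_pos rfl] at this
  exact hm (by simpa using this.symm)

/-- A factor of a nonzero weighted homogeneous polynomial is weighted homogeneous. -/
theorem IsWeightedHomogeneous.of_mul_left [IsDomain k] {w : σ → ℕ} {A B : MvPolynomial σ k} {d : ℕ}
    (h : (A * B).IsWeightedHomogeneous w d) (hA : A ≠ 0) (hB : B ≠ 0) :
    ∃ e, A.IsWeightedHomogeneous w e := by
  have hA' := gradingHom_ne_zero w hA
  have hB' := gradingHom_ne_zero w hB
  -- The highest and the lowest degree in `T` are both additive over a domain. They agree for the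
  -- product, hence for each factor.
  have h1 := Polynomial.natDegree_mul hA' hB'
  have h2 := Polynomial.natTrailingDegree_mul hA' hB'
  rw [← map_mul] at h1 h2
  have hAB := gradingHom_ne_zero w (mul_ne_zero hA hB)
  rw [isWeightedHomogeneous_iff_gradingHom] at h
  have h3 : (gradingHom w (A * B)).natDegree = d := by
    by_contra hne
    exact hAB (Polynomial.leadingCoeff_eq_zero.mp (h _ hne))
  have h4 : (gradingHom w (A * B)).natTrailingDegree = d := by
    by_contra hne
    exact hAB (Polynomial.trailingCoeff_eq_zero.mp (h _ hne))
  have h5 := Polynomial.natTrailingDegree_le_natDegree (gradingHom w A)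
  have h6 := Polynomial.natTrailingDegree_le_natDegree (gradingHom w B)
  refine ⟨(gradingHom w A).natDegree, (isWeightedHomogeneous_iff_gradingHom _ _ _).mpr ?_⟩
  intro n hn
  rcases lt_or_gt_of_ne hn with hn | hn
  · exact Polynomial.coeff_eq_zero_of_lt_natTrailingDegree (by omega)
  · exact Polynomial.coeff_eq_zero_of_natDegree_lt hn

theorem IsWeightedHomogeneous.of_mul_left_prod [IsDomain k] {w : σ → ℕ × ℕ}
    {A B : MvPolynomial σ k} {d : ℕ × ℕ}
    (h : (A * B).IsWeightedHomogeneous w d) (hA : A ≠ 0) (hB : B ≠ 0) :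
    ∃ e, A.IsWeightedHomogeneous w e := by
  obtain ⟨e₁, h₁⟩ := (h.map_weight (AddMonoidHom.fst ℕ ℕ)).of_mul_left hA hB
  obtain ⟨e₂, h₂⟩ := (h.map_weight (AddMonoidHom.snd ℕ ℕ)).of_mul_left hA hB
  refine ⟨(e₁, e₂), fun m hm => ?_⟩
  have h₁' := h₁ hm
  have h₂' := h₂ hm
  rw [Finsupp.weight_apply, Finsupp.sum] at *
  ext
  · rw [← h₁', Prod.fst_sum]; rfl
  · rw [← h₂', Prod.snd_sum]; rfl

end Factors

end MvPolynomial

/-! ### Morphisms to the projective line as pairs of forms -/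

namespace P1

variable {k : Type*} [Field k]

theorem mk_eq_mk_iff_mul {v w : Fin 2 → k} (hv : v ≠ 0) (hw : w ≠ 0) :
    (Projectivization.mk k v hv : P1 k) = Projectivization.mk k w hw ↔
      v 0 * w 1 = v 1 * w 0 := by
  rw [Projectivization.mk_eq_mk_iff']
  constructor
  · rintro ⟨a, rfl⟩
    simp only [Pi.smul_apply, smul_eq_mul]
    ring
  · intro h
    have hw' : w 0 ≠ 0 ∨ w 1 ≠ 0 := by
      by_contra! h0
      exact hw (by ext i; fin_cases i <;> simp [h0])
    rcases hw' with h0 | h1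
    · refine ⟨v 0 / w 0, ?_⟩
      ext i
      fin_cases i
      · simp [h0]
      · simp only [Fin.mk_one, Pi.smul_apply, smul_eq_mul]
        rw [div_mul_eq_mul_div, h, mul_div_cancel_right₀ _ h0]
    · refine ⟨v 1 / w 1, ?_⟩
      ext i
      fin_cases i
      · simp only [Fin.zero_eta, Pi.smul_apply, smul_eq_mul]
        rw [div_mul_eq_mul_div, ← h, mul_div_cancel_right₀ _ h1]
      · simp [h1]

end P1

namespace ProjVar

open MvPolynomial

variable {k : Type*} [Field k] {X σ M : Type*} [AddCommMonoid M]

/-- `f` is given near every point by two multihomogeneous polynomials of the same degree. -/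
def IsLocallyForms (w : σ → M) (c : X → σ → k) (f : X → P1 k) : Prop :=
  ∀ x, ∃ V : Set X, IsOpen[zariskiTopology w c] V ∧ x ∈ V ∧
    ∃ (F : Fin 2 → MvPolynomial σ k) (d : M), (∀ i, (F i).IsWeightedHomogeneous w d) ∧
      ∀ y ∈ V, ∃ h : (fun i => eval (c y) (F i)) ≠ 0, f y = Projectivization.mk k _ h

/-- `f` is given by two multihomogeneous polynomials `F 0`, `F 1` of degree `d`. -/
def IsForms (w : σ → M) (c : X → σ → k) (f : X → P1 k) (F : Fin 2 → MvPolynomial σ k) (d : M) :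
    Prop :=
  (∀ i, (F i).IsWeightedHomogeneous w d) ∧
    ∀ y, ∃ h : (fun i => eval (c y) (F i)) ≠ 0, f y = Projectivization.mk k _ h

/-- No nonzero multihomogeneous polynomial vanishes at all points. -/
def IsDense (w : σ → M) (c : X → σ → k) : Prop :=
  ∀ (F : MvPolynomial σ k) (d : M), F.IsWeightedHomogeneous w d → (∀ x, eval (c x) F = 0) → F = 0

/-- The generating nonvanishing sets are closed under finite intersection, by multiplying forms, so
they are a basis. -/
theorem exists_basicOpen {w : σ → M} {c : X → σ → k} {V : Set X}
    (hV : IsOpen[zariskiTopology w c] V) {x : X} (hx : x ∈ V) :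
    ∃ (H : MvPolynomial σ k) (d : M), H.IsWeightedHomogeneous w d ∧ eval (c x) H ≠ 0 ∧
      ∀ y, eval (c y) H ≠ 0 → y ∈ V := by
  change TopologicalSpace.GenerateOpen _ V at hV
  induction hV with
  | basic U hU =>
    obtain ⟨F, d, hF, rfl⟩ := hU
    exact ⟨F, d, hF, hx, fun _ h => h⟩
  | univ => exact ⟨1, 0, isWeightedHomogeneous_one _ _, by simp, fun _ _ => trivial⟩
  | inter U V _ _ hU hV =>
    obtain ⟨F, d, hF, hFx, hF'⟩ := hU hx.1
    obtain ⟨G, e, hG, hGx, hG'⟩ := hV hx.2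
    refine ⟨F * G, d + e, hF.mul hG, by simp [hFx, hGx], fun y hy => ?_⟩
    rw [map_mul] at hy
    exact ⟨hF' y (left_ne_zero_of_mul hy), hG' y (right_ne_zero_of_mul hy)⟩
  | sUnion S _ ih =>
    obtain ⟨U, hU, hxU⟩ := hx
    obtain ⟨F, d, hF, hFx, hF'⟩ := ih U hU hxU
    exact ⟨F, d, hF, hFx, fun y hy => ⟨U, hU, hF' y hy⟩⟩

theorem isOpen_basicOpen {w : σ → M} {c : X → σ → k} {F : MvPolynomial σ k} {d : M}
    (hF : F.IsWeightedHomogeneous w d) :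
    IsOpen[zariskiTopology w c] {x | eval (c x) F ≠ 0} :=
  TopologicalSpace.isOpen_generateFrom_of_mem ⟨F, d, hF, rfl⟩

/-- The composition of a morphism with a coordinate projection to the projective line is given
locally by pairs of forms. -/
theorem IsMorphism.isLocallyForms {w : σ → M} {c : X → σ → k} {φ : X → X}
    (hφ : IsMorphism w c φ) (π : X → P1 k) (s : Fin 2 → σ) (hw : w (s 0) = w (s 1))
    (hs : ∀ x i, c x (s i) = (π x).rep i) : IsLocallyForms w c (π ∘ φ) := by
  intro x
  -- The affine coordinate `x_j / x_i` is regular where `x_i ≠ 0`. Its pullback under `φ` is a local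
  -- quotient `F / G`, so `(G, F)` are homogeneous coordinates `(i, j)` of the map.
  have key : ∀ i j : Fin 2, i ≠ j → (π (φ x)).rep i ≠ 0 →
      ∃ V : Set X, IsOpen[zariskiTopology w c] V ∧ x ∈ V ∧
        ∃ (F G : MvPolynomial σ k) (d : M),
        F.IsWeightedHomogeneous w d ∧ G.IsWeightedHomogeneous w d ∧
        ∀ y ∈ V, (π (φ y)).rep i ≠ 0 ∧ eval (c y) G ≠ 0 ∧
        (π (φ y)).rep j / (π (φ y)).rep i = eval (c y) F / eval (c y) G := by
    intro i j hij hx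
    have hd : w (s i) = w (s j) := by fin_cases i <;> fin_cases j <;> simp_all
    let U : Set X := {y | eval (c y) (MvPolynomial.X (s i)) ≠ 0}
    have hU : IsOpen[zariskiTopology w c] U :=
      isOpen_basicOpen (isWeightedHomogeneous_X k w (s i))
    have hreg : IsRegularOn w c U fun y => (π y).rep j / (π y).rep i := by
      intro y hy
      refine ⟨U, hU, hy, subset_rfl, MvPolynomial.X (s j), MvPolynomial.X (s i), w (s i), ?_,
        isWeightedHomogeneous_X _ _ _, fun z hz => ⟨hz, by simp [hs]⟩⟩
      rw [hd]
      exact isWeightedHomogeneous_X _ _ _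
    obtain ⟨V, hV, hxV, hVU, F, G, d, hF, hG, h⟩ :=
      (hφ U hU).2 _ hreg x (by simpa [U, hs] using hx)
    refine ⟨V, hV, hxV, F, G, d, hF, hG, fun y hy => ⟨?_, h y hy⟩⟩
    simpa [U, hs] using hVU hy
  have hne := (π (φ x)).rep_nonzero
  by_cases h0 : (π (φ x)).rep 0 = 0
  · have h1 : (π (φ x)).rep 1 ≠ 0 := fun h1 => hne (by ext i; fin_cases i <;> simp [h0, h1])
    obtain ⟨V, hV, hxV, F, G, d, hF, hG, h⟩ := key 1 0 (by decide) h1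
    refine ⟨V, hV, hxV, ![F, G], d, by simp [Fin.forall_fin_two, hF, hG], fun y hy => ?_⟩
    obtain ⟨h2, h3, h4⟩ := h y hy
    refine ⟨fun hz => h3 (by simpa using congrFun hz 1), ?_⟩
    rw [Function.comp_apply, ← Projectivization.mk_rep (π (φ y)), P1.mk_eq_mk_iff_mul]
    field_simp at h4
    simpa [mul_comm] using h4
  · obtain ⟨V, hV, hxV, F, G, d, hF, hG, h⟩ := key 0 1 (by decide) h0
    refine ⟨V, hV, hxV, ![G, F], d, by simp [Fin.forall_fin_two, hF, hG], fun y hy => ?_⟩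
    obtain ⟨h2, h3, h4⟩ := h y hy
    refine ⟨fun hz => h3 (by simpa using congrFun hz 0), ?_⟩
    rw [Function.comp_apply, ← Projectivization.mk_rep (π (φ y)), P1.mk_eq_mk_iff_mul]
    field_simp at h4
    simpa [mul_comm] using h4.symm

/-- In a domain, a pair proportional to a relatively prime pair is a multiple of it. -/
theorem _root_.exists_eq_mul_of_isRelPrime {R : Type*} [CommRing R] [IsDomain R]
    [UniqueFactorizationMonoid R] {b c : Fin 2 → R} (hb : b ≠ 0) (hrel : IsRelPrime (b 0) (b 1))
    (h : b 0 * c 1 = b 1 * c 0) : ∃ e, ∀ i, c i = e * b i := by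
  by_cases h0 : b 0 = 0
  · have h1 : b 1 ≠ 0 := fun h1 => hb (by ext i; fin_cases i <;> simp [h0, h1])
    have hd : b 1 ∣ c 1 * b 0 := ⟨c 0, by rw [mul_comm, h]⟩
    obtain ⟨e, he⟩ := hrel.symm.dvd_of_dvd_mul_right hd
    refine ⟨e, ?_⟩
    have : c 0 = e * b 0 := by
      have : b 1 * c 0 = b 1 * (e * b 0) := by rw [← h, he]; ring
      exact mul_left_cancel₀ h1 this
    rw [Fin.forall_fin_two]
    exact ⟨this, by rw [he, mul_comm]⟩
  · have hd : b 0 ∣ c 0 * b 1 := ⟨c 1, by rw [mul_comm, h]⟩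
    obtain ⟨e, he⟩ := hrel.dvd_of_dvd_mul_right hd
    refine ⟨e, ?_⟩
    have : c 1 = e * b 1 := by
      have : b 0 * c 1 = b 0 * (e * b 1) := by rw [h, he]; ring
      exact mul_left_cancel₀ h0 this
    rw [Fin.forall_fin_two]
    exact ⟨by rw [he, mul_comm], this⟩

/-- A map to the projective line given locally by pairs of forms is given by one pair of forms. -/
theorem IsLocallyForms.exists_isForms [Nonempty X] {w : σ → M} {c : X → σ → k} {f : X → P1 k}
    [IsCancelAdd M] (hf : IsLocallyForms w c f) (hc : IsDense w c)
    (hfac : ∀ (A B : MvPolynomial σ k) (d : M), (A * B).IsWeightedHomogeneous w d → A ≠ 0 → B ≠ 0 →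
      ∃ e, A.IsWeightedHomogeneous w e) :
    ∃ F d, IsForms w c f F d := by
  obtain ⟨x₀⟩ := ‹Nonempty X›
  obtain ⟨V, hV, hxV, A, d, hA, hAf⟩ := hf x₀
  obtain ⟨H, e, hH, hHx, hHV⟩ := exists_basicOpen hV hxV
  have hA0 : A ≠ 0 := by
    rintro rfl
    exact (hAf x₀ hxV).1 (by ext; simp)
  have hH0 : H ≠ 0 := by rintro rfl; simp at hHx
  -- Cancel the common factor `D` of one local pair `A`; the coprime pair `B` will serve globally.
  obtain ⟨B, D, hrel, hAB⟩ : ∃ (B : Fin 2 → MvPolynomial σ k) (D : MvPolynomial σ k),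
      IsRelPrime (B 0) (B 1) ∧ ∀ i, D * B i = A i := by
    by_cases h1 : A 1 = 0
    · refine ⟨![1, 0], A 0, isRelPrime_one_left, ?_⟩
      simp [Fin.forall_fin_two, h1]
    · obtain ⟨a, b, D, hrel, h2, h3⟩ :=
        UniqueFactorizationMonoid.exists_reduced_factors' (A 0) (A 1) h1
      exact ⟨![a, b], D, hrel, by simp [Fin.forall_fin_two, h2, h3]⟩
  have hB0 : B ≠ 0 := by
    rintro rfl
    exact hA0 (by ext1 i; simp [← hAB i])
  have hD0 : D ≠ 0 := by
    rintro rfl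
    exact hA0 (by ext1 i; simp [← hAB i])
  obtain ⟨i₀, hi₀⟩ := Function.ne_iff.mp hB0
  simp only [Pi.zero_apply] at hi₀
  obtain ⟨dD, hdD⟩ := hfac D (B i₀) d (by rw [hAB]; exact hA _) hD0 hi₀
  have hdB : ∀ i, B i ≠ 0 → ∃ e, (B i).IsWeightedHomogeneous w e ∧ dD + e = d := by
    intro i hi
    obtain ⟨e, he⟩ := hfac (B i) D d (by rw [mul_comm, hAB]; exact hA _) hi hD0
    refine ⟨e, he, IsWeightedHomogeneous.inj_right (mul_ne_zero hD0 hi) (hdD.mul he) ?_⟩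
    rw [hAB]; exact hA i
  obtain ⟨dB, hdB₀, hadd⟩ := hdB i₀ hi₀
  have hdB' : ∀ i, (B i).IsWeightedHomogeneous w dB := by
    intro i
    by_cases hi : B i = 0
    · rw [hi]; exact isWeightedHomogeneous_zero _ _ _
    · obtain ⟨e, he, hadd'⟩ := hdB i hi
      have : e = dB := add_left_cancel (hadd'.trans hadd.symm)
      exact this ▸ he
  refine ⟨B, dB, hdB', fun y => ?_⟩
  obtain ⟨V', hV', hyV', C, d', hC, hCf⟩ := hf y
  obtain ⟨H', e', hH', hHy', hHV'⟩ := exists_basicOpen hV' hyV'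
  have hH0' : H' ≠ 0 := by rintro rfl; simp at hHy'
  -- The two local pairs are proportional where `H * H'` does not vanish. Multiplying by `H * H'`
  -- gives a form that vanishes at every point, so density applies.
  have hAC : A 0 * C 1 = A 1 * C 0 := by
    have : (A 0 * C 1 - A 1 * C 0) * (H * H') = 0 := by
      refine hc _ (d + d' + (e + e'))
        ((((hA 0).mul (hC 1)).sub ((hA 1).mul (hC 0))).mul (hH.mul hH')) fun x => ?_
      simp only [map_mul, map_sub]
      by_cases h1 : eval (c x) H = 0
      · simp [h1]
      by_cases h2 : eval (c x) H' = 0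
      · simp [h2]
      obtain ⟨h3, h4⟩ := hAf x (hHV x h1)
      obtain ⟨h5, h6⟩ := hCf x (hHV' x h2)
      rw [h4, P1.mk_eq_mk_iff_mul] at h6
      rw [h6]
      ring
    rcases mul_eq_zero.mp this with h | h
    · exact sub_eq_zero.mp h
    · exact absurd h (mul_ne_zero hH0 hH0')
  have hBC : B 0 * C 1 = B 1 * C 0 := by
    refine mul_left_cancel₀ hD0 ?_
    rw [← mul_assoc, ← mul_assoc, hAB, hAB, hAC]
  -- By coprimality `C` is a multiple of `B`, so `B` cannot vanish at `y`, where `C` does not.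
  obtain ⟨E, hE⟩ := exists_eq_mul_of_isRelPrime hB0 hrel hBC
  obtain ⟨h1, h2⟩ := hCf y hyV'
  have h3 : (fun i => eval (c y) (B i)) ≠ 0 := by
    intro h3
    refine h1 ?_
    ext i
    have := congrFun h3 i
    simp only [Pi.zero_apply] at this ⊢
    rw [hE, map_mul, this, mul_zero]
  refine ⟨h3, ?_⟩
  rw [h2, P1.mk_eq_mk_iff_mul]
  simp only [hE, map_mul]
  ring

end ProjVar

/-! ### Common zeros of forms, and maps from the product to the line -/

namespace P1xP1

open MvPolynomial

variable {k : Type*} [Field k]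

/-- The character of the grading monoid `ℕ × ℕ` with values `a ^ m * b ^ n`. -/
def character (a b : k) : Multiplicative (ℕ × ℕ) →* k where
  toFun d := a ^ d.toAdd.1 * b ^ d.toAdd.2
  map_one' := by simp
  map_mul' x y := by
    simp only [toAdd_mul, Prod.fst_add, Prod.snd_add, pow_add]
    ring

theorem eval_smul_smul {F : MvPolynomial (Fin 2 ⊕ Fin 2) k} {d : ℕ × ℕ}
    (hF : F.IsWeightedHomogeneous P1xP1.weight d) (a b : k) (v w : Fin 2 → k) :
    eval (Sum.elim (a • v) (b • w)) F = a ^ d.1 * b ^ d.2 * eval (Sum.elim v w) F := by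
  rw [show a ^ d.1 * b ^ d.2 = character a b (.ofAdd d) from rfl, ← hF.eval_smul]
  congr 1
  congr 1
  ext s
  rcases s with s | s <;> simp [character, weight]

end P1xP1

namespace P1

open MvPolynomial

variable {k : Type*} [Field k]

theorem eval_smul {F : MvPolynomial (Fin 2) k} {d : ℕ}
    (hF : F.IsWeightedHomogeneous P1.weight d) (a : k) (v : Fin 2 → k) :
    eval (a • v) F = a ^ d * eval v F := by
  have := hF.eval_smul (powersHom k a) v
  simp only [P1.weight, powersHom_apply, toAdd_ofAdd, pow_one] at this
  exact this

theorem exists_rep_mk {v : Fin 2 → k} (hv : v ≠ 0) :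
    ∃ a : k, a ≠ 0 ∧ (Projectivization.mk k v hv : P1 k).rep = a • v := by
  obtain ⟨a, ha⟩ := Projectivization.exists_smul_eq_mk_rep k v hv
  exact ⟨a, a.ne_zero, ha.symm⟩

theorem isDense [Infinite k] : ProjVar.IsDense P1.weight (P1.coords k) := by
  intro F d hF h
  -- The hypothesis says nothing about the zero vector, which represents no point; the factor `X 0`
  -- vanishes there.
  have h1 : X 0 * F = 0 := by
    refine MvPolynomial.funext fun v => ?_
    rw [map_mul, eval_X, map_zero]
    by_cases hv : v = 0
    · simp [hv]
    obtain ⟨a, ha, hav⟩ := exists_rep_mk hv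
    have h2 := h (Projectivization.mk k v hv)
    rw [P1.coords, hav, eval_smul hF] at h2
    rw [(mul_eq_zero.mp h2).resolve_left (pow_ne_zero _ ha), mul_zero]
  exact (mul_eq_zero.mp h1).resolve_left (X_ne_zero _)

/-- The map defined by a pair of forms can be computed from arbitrary homogeneous coordinates. -/
theorem eval_of_isForms {f : P1 k → P1 k} {F : Fin 2 → MvPolynomial (Fin 2) k} {d : ℕ}
    (hf : ProjVar.IsForms P1.weight (P1.coords k) f F d) {v : Fin 2 → k} (hv : v ≠ 0) :
    ∃ h : (fun i => eval v (F i)) ≠ 0,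
      f (Projectivization.mk k v hv) = Projectivization.mk k _ h := by
  obtain ⟨a, ha, hav⟩ := exists_rep_mk hv
  obtain ⟨h1, h2⟩ := hf.2 (Projectivization.mk k v hv)
  have h3 : ∀ i, eval (P1.coords k (Projectivization.mk k v hv)) (F i) = a ^ d * eval v (F i) :=
    fun i => by rw [P1.coords, hav, eval_smul (hf.1 i)]
  have h4 : (fun i => eval v (F i)) ≠ 0 := by
    intro h4
    refine h1 ?_
    ext i
    rw [h3, congrFun h4 i]
    simp
  refine ⟨h4, ?_⟩
  rw [h2, mk_eq_mk_iff_mul]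
  simp only [h3]
  ring

end P1

namespace P1xP1

open MvPolynomial

variable {k : Type*} [Field k]

theorem isDense [Infinite k] : ProjVar.IsDense P1xP1.weight (P1xP1.coords k) := by
  intro F d hF h
  have h1 : X (.inl 0) * X (.inr 0) * F = 0 := by
    refine MvPolynomial.funext fun u => ?_
    obtain ⟨v, w, rfl⟩ : ∃ v w, u = Sum.elim v w := ⟨_, _, (Sum.elim_comp_inl_inr u).symm⟩
    simp only [map_mul, eval_X, map_zero, Sum.elim_inl, Sum.elim_inr]
    by_cases hv : v = 0
    · simp [hv]
    by_cases hw : w = 0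
    · simp [hw]
    obtain ⟨a, ha, hav⟩ := P1.exists_rep_mk hv
    obtain ⟨b, hb, hbw⟩ := P1.exists_rep_mk hw
    have h2 := h (Projectivization.mk k v hv, Projectivization.mk k w hw)
    rw [P1xP1.coords, hav, hbw, eval_smul_smul hF] at h2
    rw [(mul_eq_zero.mp h2).resolve_left (mul_ne_zero (pow_ne_zero _ ha) (pow_ne_zero _ hb)),
      mul_zero]
  exact (mul_eq_zero.mp h1).resolve_left (mul_ne_zero (X_ne_zero _) (X_ne_zero _))

theorem eval_of_isForms {f : P1xP1 k → P1 k} {F : Fin 2 → MvPolynomial (Fin 2 ⊕ Fin 2) k}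
    {d : ℕ × ℕ} (hf : ProjVar.IsForms P1xP1.weight (P1xP1.coords k) f F d)
    {v w : Fin 2 → k} (hv : v ≠ 0) (hw : w ≠ 0) :
    ∃ h : (fun i => eval (Sum.elim v w) (F i)) ≠ 0,
      f (Projectivization.mk k v hv, Projectivization.mk k w hw) = Projectivization.mk k _ h := by
  obtain ⟨a, ha, hav⟩ := P1.exists_rep_mk hv
  obtain ⟨b, hb, hbw⟩ := P1.exists_rep_mk hw
  obtain ⟨h1, h2⟩ := hf.2 (Projectivization.mk k v hv, Projectivization.mk k w hw)
  have h3 : ∀ i, eval (P1xP1.coords k (Projectivization.mk k v hv, Projectivization.mk k w hw))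
      (F i) = a ^ d.1 * b ^ d.2 * eval (Sum.elim v w) (F i) :=
    fun i => by rw [P1xP1.coords, hav, hbw, eval_smul_smul (hf.1 i)]
  have h4 : (fun i => eval (Sum.elim v w) (F i)) ≠ 0 := by
    intro h4
    refine h1 ?_
    ext i
    rw [h3, congrFun h4 i]
    simp
  refine ⟨h4, ?_⟩
  rw [h2, P1.mk_eq_mk_iff_mul]
  simp only [h3]
  ring

/-- Setting the first variable of the second factor to be a polynomial variable and the second one
to `1` turns a bihomogeneous polynomial into a polynomial with homogeneous coefficients. -/
theorem exists_dehomogenization {F : MvPolynomial (Fin 2 ⊕ Fin 2) k} {a b : ℕ}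
    (hF : F.IsWeightedHomogeneous P1xP1.weight (a, b)) :
    ∃ P : Polynomial (MvPolynomial (Fin 2) k), P.natDegree ≤ a ∧
      (∀ n, (P.coeff n).IsHomogeneous b) ∧
      (∀ w t, (P.map (eval w)).eval t = eval (Sum.elim ![t, 1] w) F) ∧
      ∀ w, eval w (P.coeff a) = eval (Sum.elim ![1, 0] w) F := by
  induction hF using IsWeightedHomogeneous.induction_on with
  | zero => exact ⟨0, by simp, by simp [isHomogeneous_zero], by simp, by simp⟩
  | add F G _ _ hF hG =>
    obtain ⟨P, hP1, hP2, hP3, hP4⟩ := hF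
    obtain ⟨Q, hQ1, hQ2, hQ3, hQ4⟩ := hG
    refine ⟨P + Q, (Polynomial.natDegree_add_le _ _).trans (max_le hP1 hQ1), fun n => ?_,
      fun w t => ?_, fun w => ?_⟩
    · rw [Polynomial.coeff_add]
      exact (hP2 n).add (hQ2 n)
    · rw [Polynomial.map_add, Polynomial.eval_add, map_add, hP3, hQ3]
    · rw [Polynomial.coeff_add, map_add, map_add, hP4, hQ4]
  | monomial m r hm =>
    rw [Finsupp.weight_apply, Finsupp.sum_fintype _ _ (by simp)] at hm
    simp only [Fintype.sum_sum_type, Fin.sum_univ_two, weight, Sum.elim_inl, Sum.elim_inr,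
      Prod.smul_mk, smul_eq_mul, mul_one, mul_zero, Prod.mk_add_mk, add_zero, zero_add,
      Prod.mk.injEq] at hm
    obtain ⟨rfl, rfl⟩ := hm
    have hev : ∀ u : Fin 2 ⊕ Fin 2 → k, eval u (monomial m r) =
        r * (u (.inl 0) ^ m (.inl 0) * u (.inl 1) ^ m (.inl 1) *
          (u (.inr 0) ^ m (.inr 0) * u (.inr 1) ^ m (.inr 1))) := by
      intro u
      rw [eval_monomial, Finsupp.prod_fintype _ _ (by simp)]
      simp
    refine ⟨Polynomial.C (C r * (X 0 ^ m (.inr 0) * X 1 ^ m (.inr 1))) *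
      Polynomial.X ^ m (.inl 0), (Polynomial.natDegree_C_mul_X_pow_le _ _).trans (by omega),
      fun n => ?_, fun w t => ?_, fun w => ?_⟩
    · rw [Polynomial.coeff_C_mul_X_pow]
      split_ifs
      · refine IsHomogeneous.C_mul (IsHomogeneous.mul ?_ ?_) r
        · simpa using (isHomogeneous_X k (0 : Fin 2)).pow (m (.inr 0))
        · simpa using (isHomogeneous_X k (1 : Fin 2)).pow (m (.inr 1))
      · exact isHomogeneous_zero _ _ _
    · rw [hev]
      simp
      ring
    · rw [hev, Polynomial.coeff_C_mul_X_pow]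
      by_cases h : m (.inl 1) = 0
      · simp [h]
      · simp [h]

/-- With formal degree `a` for both polynomials, the resultant detects common zeros on the
projective line; vanishing of both coefficients of degree `a` is a common zero at infinity. -/
theorem _root_.Polynomial.exists_common_root_of_resultant_eq_zero [IsAlgClosed k]
    {f g : Polynomial k} {a : ℕ} (hf : f.natDegree ≤ a) (hg : g.natDegree ≤ a)
    (h : Polynomial.resultant f g a a = 0) :
    (f.coeff a = 0 ∧ g.coeff a = 0) ∨ ∃ t, f.eval t = 0 ∧ g.eval t = 0 := by
  have key : ∀ {f g : Polynomial k}, f.natDegree ≤ a → g.natDegree ≤ a →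
      Polynomial.resultant f g a a = 0 → f.coeff a ≠ 0 → ∃ t, f.eval t = 0 ∧ g.eval t = 0 := by
    intro f g hf hg h hfa
    have hfa' : f.natDegree = a := le_antisymm hf (Polynomial.le_natDegree_of_ne_zero hfa)
    obtain ⟨c, hc⟩ := Nat.exists_eq_add_of_le hg
    -- Raising the formal degree of `g` by `c` only introduces the factor `f.coeff a ^ c`, which is
    -- nonzero here.
    have h1 := Polynomial.resultant_add_right_deg f g a g.natDegree c le_rfl
    rw [← hc, h] at h1
    have h2 : Polynomial.resultant f g = 0 := by
      rw [hfa']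
      exact (mul_eq_zero.mp h1.symm).resolve_left (pow_ne_zero _ hfa)
    rw [Polynomial.resultant_eq_zero_iff] at h2
    by_contra! h3
    refine h2.2 ?_
    rw [Polynomial.isCoprime_iff_aeval_ne_zero_of_isAlgClosed k k]
    intro t
    by_cases h4 : f.eval t = 0
    · right; simpa using h3 t h4
    · left; simpa using h4
  by_cases h1 : f.coeff a = 0
  · by_cases h2 : g.coeff a = 0
    · exact .inl ⟨h1, h2⟩
    · rw [Polynomial.resultant_comm] at h
      obtain ⟨t, h3, h4⟩ := key hg hf
        ((mul_eq_zero.mp h).resolve_left (pow_ne_zero _ (by simp))) h2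
      exact .inr ⟨t, h4, h3⟩
  · exact .inr (key hf hg h h1)

/-- The Sylvester matrix has size `m + n`, and each entry is zero or a form of degree `b`. -/
theorem isHomogeneous_resultant {R : Type*} [CommRing R] {σ : Type*}
    {P Q : Polynomial (MvPolynomial σ R)}
    {b : ℕ} (hP : ∀ n, (P.coeff n).IsHomogeneous b) (hQ : ∀ n, (Q.coeff n).IsHomogeneous b)
    (m n : ℕ) : (Polynomial.resultant P Q m n).IsHomogeneous ((m + n) * b) := by
  rw [Polynomial.resultant, Matrix.det_apply]
  refine IsHomogeneous.sum _ _ _ fun σ _ => ?_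
  rw [Units.smul_def]
  refine (homogeneousSubmodule _ R _).toAddSubgroup.zsmul_mem (x := ∏ i, _) ?_ _
  have h : (m + n) * b = ∑ _i : Fin (m + n), b := by simp
  rw [h]
  refine IsHomogeneous.prod _ _ _ fun i _ => ?_
  rw [Polynomial.sylvester, Matrix.of_apply]
  induction i using Fin.addCases with
  | left i =>
    rw [Fin.addCases_left]
    split_ifs
    · exact hQ _
    · exact isHomogeneous_zero _ _ _
  | right i =>
    rw [Fin.addCases_right]
    split_ifs
    · exact hP _
    · exact isHomogeneous_zero _ _ _

end P1xP1

namespace P1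

open MvPolynomial

variable {k : Type*} [Field k]

/-- The univariate polynomial `F(t, 1)` attached to a binary form `F`. -/
theorem exists_dehomogenization {F : MvPolynomial (Fin 2) k} {a : ℕ}
    (hF : F.IsWeightedHomogeneous P1.weight a) :
    ∃ P : Polynomial k, P.natDegree ≤ a ∧ (∀ t, P.eval t = eval ![t, 1] F) ∧
      P.coeff a = eval ![1, 0] F := by
  have hev : ∀ v w : Fin 2 → k, eval (Sum.elim v w) (aeval (fun i => X (.inl i)) F :
      MvPolynomial (Fin 2 ⊕ Fin 2) k) = eval v F := by
    intro v w
    rw [← aeval_eq_eval, ← aeval_eq_eval, ← AlgHom.comp_apply, comp_aeval]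
    simp
  have h1 : (aeval (fun i => X (.inl i)) F : MvPolynomial (Fin 2 ⊕ Fin 2) k).IsWeightedHomogeneous
      P1xP1.weight (AddMonoidHom.inl ℕ ℕ a) := by
    refine hF.aeval (AddMonoidHom.inl ℕ ℕ) _ fun i => ?_
    rw [show AddMonoidHom.inl ℕ ℕ (P1.weight i) = P1xP1.weight (.inl i) from rfl]
    exact isWeightedHomogeneous_X k P1xP1.weight (.inl i)
  obtain ⟨P, hP1, -, hP3, hP4⟩ := P1xP1.exists_dehomogenization h1
  refine ⟨P.map (eval 0), Polynomial.natDegree_map_le.trans hP1, fun t => ?_, ?_⟩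
  · rw [hP3, hev]
  · rw [Polynomial.coeff_map, hP4, hev]

theorem vec_one_zero_ne_zero : (![1, 0] : Fin 2 → k) ≠ 0 := fun h => one_ne_zero (congrFun h 0)

theorem vec_one_ne_zero (t : k) : (![t, 1] : Fin 2 → k) ≠ 0 := fun h => one_ne_zero (congrFun h 1)

theorem exists_eval_eq_zero [IsAlgClosed k] {F : MvPolynomial (Fin 2) k} {a : ℕ}
    (hF : F.IsWeightedHomogeneous P1.weight a) (ha : a ≠ 0) : ∃ v, v ≠ 0 ∧ eval v F = 0 := by
  obtain ⟨P, hP1, hP2, hP3⟩ := exists_dehomogenization hF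
  by_cases h : P.coeff a = 0
  · exact ⟨![1, 0], vec_one_zero_ne_zero, hP3 ▸ h⟩
  · obtain ⟨t, ht⟩ := IsAlgClosed.exists_root P fun h0 => by
      have := Polynomial.le_natDegree_of_ne_zero h
      have : P.natDegree = 0 := Polynomial.natDegree_eq_of_degree_eq_some h0
      omega
    exact ⟨![t, 1], vec_one_ne_zero t, hP2 t ▸ ht⟩

end P1

namespace P1xP1

open MvPolynomial

variable {k : Type*} [Field k]

/-- Two bihomogeneous polynomials of the same bidegree `(a, b)` with `a`, `b` positive have a common
zero on `ℙ¹ × ℙ¹`. -/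
theorem exists_common_zero [IsAlgClosed k] {F : Fin 2 → MvPolynomial (Fin 2 ⊕ Fin 2) k} {a b : ℕ}
    (hF : ∀ i, (F i).IsWeightedHomogeneous P1xP1.weight (a, b)) (ha : a ≠ 0) (hb : b ≠ 0) :
    ∃ v w, v ≠ 0 ∧ w ≠ 0 ∧ ∀ i, eval (Sum.elim v w) (F i) = 0 := by
  choose P hP1 hP2 hP3 hP4 using fun i => exists_dehomogenization (hF i)
  -- Eliminating the first pair of variables leaves a binary form of degree `(a + a) * b` in the
  -- second pair. The degree is positive, so there is a zero `w`; over it the two restricted forms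
  -- have a common zero, possibly `(1 : 0)`.
  obtain ⟨w, hw, hw'⟩ := P1.exists_eval_eq_zero
    (isHomogeneous_resultant (hP2 0) (hP2 1) a a)
    (mul_ne_zero (by omega) hb)
  rw [← Polynomial.resultant_map_map] at hw'
  rcases Polynomial.exists_common_root_of_resultant_eq_zero
    (Polynomial.natDegree_map_le.trans (hP1 0)) (Polynomial.natDegree_map_le.trans (hP1 1)) hw'
    with h | ⟨t, h⟩
  · refine ⟨![1, 0], w, P1.vec_one_zero_ne_zero, hw, ?_⟩
    simpa [Fin.forall_fin_two, Polynomial.coeff_map, hP4] using h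
  · refine ⟨![t, 1], w, P1.vec_one_ne_zero t, hw, ?_⟩
    simpa [Fin.forall_fin_two, hP3] using h

/-- A map from `ℙ¹ × ℙ¹` to `ℙ¹` given by forms factors through one of the projections. -/
theorem exists_factorization_of_isForms [IsAlgClosed k] {f : P1xP1 k → P1 k}
    {F : Fin 2 → MvPolynomial (Fin 2 ⊕ Fin 2) k} {d : ℕ × ℕ}
    (hf : ProjVar.IsForms P1xP1.weight (P1xP1.coords k) f F d) :
    ∃ (h : P1 k → P1 k) (H : Fin 2 → MvPolynomial (Fin 2) k) (e : ℕ),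
      ProjVar.IsForms P1.weight (P1.coords k) h H e ∧
      ((∀ x, f x = h x.1) ∨ ∀ x, f x = h x.2) := by
  obtain ⟨a, b⟩ := d
  have hab : b = 0 ∨ a = 0 := by
    by_contra! hab
    obtain ⟨v, w, hv, hw, hvw⟩ := exists_common_zero hf.1 hab.2 hab.1
    exact (eval_of_isForms hf hv hw).1 (funext hvw)
  rcases hab with rfl | rfl
  · have hev : ∀ i v w, eval (Sum.elim v w) (F i) =
        eval v (aeval (Sum.elim X 0) (F i) : MvPolynomial (Fin 2) k) := by
      intro i v w
      -- In bidegree `(a, 0)`, scaling the second pair by `0` multiplies the value by `0 ^ 0 = 1`: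
      -- the second pair does not matter.
      have h1 := eval_smul_smul (hf.1 i) 1 0 v w
      simp only [one_smul, zero_smul, one_pow, pow_zero, mul_one, one_mul] at h1
      rw [← h1, ← aeval_eq_eval, ← aeval_eq_eval, ← AlgHom.comp_apply, comp_aeval]
      congr 2
      ext s
      rcases s with s | s <;> simp
    have hH : ∀ i, (aeval (Sum.elim X 0) (F i) : MvPolynomial (Fin 2) k).IsWeightedHomogeneous
        P1.weight a := fun i => by
      refine (hf.1 i).aeval (AddMonoidHom.fst ℕ ℕ) _ fun s => ?_
      rcases s with s | s
      · exact isWeightedHomogeneous_X _ _ _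
      · exact isWeightedHomogeneous_zero _ _ _
    have hw : (![1, 0] : Fin 2 → k) ≠ 0 := P1.vec_one_zero_ne_zero
    have hne : ∀ p : P1 k, (fun i => eval p.rep
        (aeval (Sum.elim X 0) (F i) : MvPolynomial (Fin 2) k)) ≠ 0 := fun p => by
      simp only [← hev _ p.rep ![1, 0]]
      exact (eval_of_isForms hf p.rep_nonzero hw).1
    refine ⟨fun p => Projectivization.mk k _ (hne p), _, a, ⟨hH, fun p => ⟨hne p, rfl⟩⟩,
      .inl fun x => ?_⟩
    obtain ⟨h1, h2⟩ := hf.2 x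
    rw [h2, P1.mk_eq_mk_iff_mul]
    simp only [P1xP1.coords, hev]
    ring
  · have hev : ∀ i v w, eval (Sum.elim v w) (F i) =
        eval w (aeval (Sum.elim 0 X) (F i) : MvPolynomial (Fin 2) k) := by
      intro i v w
      have h1 := eval_smul_smul (hf.1 i) 0 1 v w
      simp only [one_smul, zero_smul, one_pow, pow_zero, mul_one, one_mul] at h1
      rw [← h1, ← aeval_eq_eval, ← aeval_eq_eval, ← AlgHom.comp_apply, comp_aeval]
      congr 2
      ext s
      rcases s with s | s <;> simp
    have hH : ∀ i, (aeval (Sum.elim 0 X) (F i) : MvPolynomial (Fin 2) k).IsWeightedHomogeneous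
        P1.weight b := fun i => by
      refine (hf.1 i).aeval (AddMonoidHom.snd ℕ ℕ) _ fun s => ?_
      rcases s with s | s
      · exact isWeightedHomogeneous_zero _ _ _
      · exact isWeightedHomogeneous_X _ _ _
    have hw : (![1, 0] : Fin 2 → k) ≠ 0 := P1.vec_one_zero_ne_zero
    have hne : ∀ p : P1 k, (fun i => eval p.rep
        (aeval (Sum.elim 0 X) (F i) : MvPolynomial (Fin 2) k)) ≠ 0 := fun p => by
      simp only [← hev _ ![1, 0] p.rep]
      exact (eval_of_isForms hf hw p.rep_nonzero).1
    refine ⟨fun p => Projectivization.mk k _ (hne p), _, b, ⟨hH, fun p => ⟨hne p, rfl⟩⟩,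
      .inr fun x => ?_⟩
    obtain ⟨h1, h2⟩ := hf.2 x
    rw [h2, P1.mk_eq_mk_iff_mul]
    simp only [P1xP1.coords, hev]
    ring

end P1xP1

theorem MvPolynomial.IsWeightedHomogeneous.aeval_of_weight_eq {k σ τ M : Type*} [CommSemiring k]
    [AddCommMonoid M] {w : σ → M} {F : MvPolynomial σ k} {d : M} (hF : F.IsWeightedHomogeneous w d)
    {w' : τ → M} (P : σ → MvPolynomial τ k) (hP : ∀ s, (P s).IsWeightedHomogeneous w' (w s)) :
    (MvPolynomial.aeval P F).IsWeightedHomogeneous w' d :=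
  hF.aeval (AddMonoidHom.id M) P hP

/-! ### Automorphisms of the projective line are projective linear -/

namespace P1

open MvPolynomial

variable {k : Type*} [Field k]

variable (k) in
/-- The group of projective linear transformations of the projective line. -/
def PL : Subgroup (Equiv.Perm (P1 k)) :=
  (MulAction.toPermHom ((Fin 2 → k) ≃ₗ[k] (Fin 2 → k)) (P1 k)).range

/-- The coordinates of a linear map as linear forms in two variables `s 0`, `s 1`. -/
noncomputable def linForm {σ : Type*} (g : (Fin 2 → k) →ₗ[k] (Fin 2 → k)) (s : Fin 2 → σ)
    (i : Fin 2) : MvPolynomial σ k :=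
  ∑ j, C (g (fun l => if j = l then 1 else 0) i) * X (s j)

theorem eval_linForm {σ : Type*} (g : (Fin 2 → k) →ₗ[k] (Fin 2 → k)) (s : Fin 2 → σ) (i : Fin 2)
    (u : σ → k) : eval u (linForm g s i) = g (fun j => u (s j)) i := by
  conv_rhs => rw [LinearMap.pi_apply_eq_sum_univ g]
  simp [linForm, mul_comm]

theorem isWeightedHomogeneous_linForm {σ M : Type*} [AddCommMonoid M] {w : σ → M} {m : M}
    (g : (Fin 2 → k) →ₗ[k] (Fin 2 → k)) (s : Fin 2 → σ) (hs : ∀ j, w (s j) = m) (i : Fin 2) :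
    (linForm g s i).IsWeightedHomogeneous w m := by
  refine IsWeightedHomogeneous.sum _ _ _ fun j _ => IsWeightedHomogeneous.C_mul ?_ _
  rw [← hs j]
  exact isWeightedHomogeneous_X _ _ _

theorem isForms_comp_smul {h : P1 k → P1 k} {F : Fin 2 → MvPolynomial (Fin 2) k} {d : ℕ}
    (hF : ProjVar.IsForms P1.weight (P1.coords k) h F d)
    (g : (Fin 2 → k) ≃ₗ[k] (Fin 2 → k)) :
    ProjVar.IsForms P1.weight (P1.coords k) (fun p => h (g • p))
      (fun i => aeval (linForm g.toLinearMap id) (F i)) d := by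
  have hev : ∀ i v, eval v (aeval (linForm g.toLinearMap id) (F i)) = eval (g v) (F i) := by
    intro i v
    rw [← aeval_eq_eval, ← aeval_eq_eval, ← AlgHom.comp_apply, comp_aeval]
    congr 2
    ext j
    simp only [aeval_eq_eval, eval_linForm]
    rfl
  have hlin : ∀ j, (linForm g.toLinearMap id j).IsWeightedHomogeneous P1.weight (P1.weight j) :=
    fun j => isWeightedHomogeneous_linForm (m := P1.weight j) g.toLinearMap id (fun _ => rfl) j
  refine ⟨fun i => (hF.1 i).aeval_of_weight_eq (linForm g.toLinearMap id) hlin, fun p => ?_⟩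
  simp only [hev, coords]
  have hp : g p.rep ≠ 0 := (LinearEquiv.map_ne_zero_iff g).mpr p.rep_nonzero
  obtain ⟨h1, h2⟩ := eval_of_isForms hF hp
  refine ⟨h1, ?_⟩
  rw [← h2]
  congr 1
  conv_lhs => rw [← p.mk_rep, Projectivization.smul_mk]
  rfl

/-- The linear automorphism with diagonal matrix. -/
noncomputable def diagEquiv (c d : kˣ) : (Fin 2 → k) ≃ₗ[k] (Fin 2 → k) :=
  LinearEquiv.piCongrRight fun i => LinearEquiv.smulOfUnit (![c, d] i)

theorem diagEquiv_apply (c d : kˣ) (v : Fin 2 → k) :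
    diagEquiv c d v = ![(c : k) * v 0, d * v 1] := by
  ext i
  fin_cases i <;> rfl

theorem vec_zero_one_ne_zero : (![0, 1] : Fin 2 → k) ≠ 0 := vec_one_ne_zero 0

/-- A bijection given by forms that fixes `0` and `∞` is a scaling. -/
theorem exists_diag_of_isForms [IsAlgClosed k] [CharZero k] {h : P1 k → P1 k}
    {F : Fin 2 → MvPolynomial (Fin 2) k} {a : ℕ}
    (hF : ProjVar.IsForms P1.weight (P1.coords k) h F a) (hinj : Function.Injective h)
    (h0 : h (Projectivization.mk k ![0, 1] vec_zero_one_ne_zero) =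
      Projectivization.mk k ![0, 1] vec_zero_one_ne_zero)
    (h1 : h (Projectivization.mk k ![1, 0] vec_one_zero_ne_zero) =
      Projectivization.mk k ![1, 0] vec_one_zero_ne_zero) :
    ∃ g : (Fin 2 → k) ≃ₗ[k] (Fin 2 → k), ∀ p, h p = g • p := by
  -- By injectivity only `0` maps to `0`, and likewise only `∞` to `∞`. This locates all zeros of
  -- the two forms, so in the affine coordinate they are `c * t ^ a` and a constant `d`.
  have hF0 : ∀ v (hv : v ≠ 0), eval v (F 0) = 0 ↔ v 0 = 0 := by
    intro v hv
    obtain ⟨h2, h3⟩ := eval_of_isForms hF hv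
    have : h (Projectivization.mk k v hv) = Projectivization.mk k ![0, 1] vec_zero_one_ne_zero ↔
        Projectivization.mk k v hv = Projectivization.mk k ![0, 1] vec_zero_one_ne_zero :=
      ⟨fun e => hinj (e.trans h0.symm), fun e => by rw [e, h0]⟩
    rw [h3, mk_eq_mk_iff_mul, mk_eq_mk_iff_mul] at this
    simpa using this
  have hF1 : ∀ v (hv : v ≠ 0), eval v (F 1) = 0 ↔ v 1 = 0 := by
    intro v hv
    obtain ⟨h2, h3⟩ := eval_of_isForms hF hv
    have : h (Projectivization.mk k v hv) = Projectivization.mk k ![1, 0] vec_one_zero_ne_zero ↔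
        Projectivization.mk k v hv = Projectivization.mk k ![1, 0] vec_one_zero_ne_zero :=
      ⟨fun e => hinj (e.trans h1.symm), fun e => by rw [e, h1]⟩
    rw [h3, mk_eq_mk_iff_mul, mk_eq_mk_iff_mul] at this
    simpa [eq_comm] using this
  obtain ⟨P, hP1, hP2, hP3⟩ := exists_dehomogenization (hF.1 0)
  obtain ⟨Q, hQ1, hQ2, -⟩ := exists_dehomogenization (hF.1 1)
  have hPa : P.coeff a ≠ 0 := by
    rw [hP3, Ne, hF0 _ vec_one_zero_ne_zero]
    simp
  have hPdeg : P.natDegree = a := le_antisymm hP1 (Polynomial.le_natDegree_of_ne_zero hPa)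
  have hP0 : P ≠ 0 := by rintro rfl; simp at hPa
  obtain ⟨c, hc, hPc⟩ : ∃ c, c ≠ 0 ∧ ∀ t, P.eval t = c * t ^ a := by
    have hs := IsAlgClosed.splits P
    have hroots : P.roots = Multiset.replicate a 0 := by
      rw [Multiset.eq_replicate]
      refine ⟨by rw [← hPdeg]; exact hs.natDegree_eq_card_roots.symm, fun t ht => ?_⟩
      rw [Polynomial.mem_roots hP0, Polynomial.IsRoot.def, hP2,
        hF0 _ (vec_one_ne_zero t)] at ht
      simpa using ht
    refine ⟨P.leadingCoeff, by simpa using hP0, fun t => ?_⟩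
    conv_lhs => rw [hs.eq_prod_roots, hroots]
    simp
  obtain ⟨d, hd, hQd⟩ : ∃ d, d ≠ 0 ∧ ∀ t, Q.eval t = d := by
    have hroot : ∀ t, Q.eval t ≠ 0 := fun t => by
      rw [hQ2, Ne, hF1 _ (vec_one_ne_zero t)]
      simp
    have hdeg : Q.degree = 0 := by
      by_contra h
      obtain ⟨t, ht⟩ := IsAlgClosed.exists_root Q h
      exact hroot t ht
    obtain ⟨d, hd⟩ : ∃ d, Q = Polynomial.C d := ⟨_, Polynomial.eq_C_of_degree_eq_zero hdeg⟩
    refine ⟨d, ?_, fun t => by simp [hd]⟩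
    rintro rfl
    exact hroot 0 (by simp [hd])
  have hh : ∀ t, ∃ hv, h (Projectivization.mk k ![t, 1] (vec_one_ne_zero t)) =
      Projectivization.mk k ![c * t ^ a, d] hv := by
    intro t
    obtain ⟨h2, h3⟩ := eval_of_isForms hF (vec_one_ne_zero t)
    have : (fun i => eval ![t, 1] (F i)) = ![c * t ^ a, d] := by
      ext i
      fin_cases i
      · simp [← hPc, hP2]
      · simp [← hQd t, hQ2]
    simp only [this] at h3 h2
    exact ⟨h2, h3⟩
  have ha0 : a ≠ 0 := by
    rintro rfl
    have := (hF0 _ (vec_one_ne_zero 0)).mpr (by simp)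
    rw [← hP2, hPc] at this
    simp [hc] at this
  -- For a primitive `a`-th root of unity `ζ`, the points `ζ` and `1` have the same image under `t ↦
  -- (c / d) t ^ a`. Characteristic zero supplies `ζ` and excludes Frobenius.
  have ha : a = 1 := by
    have : NeZero (a : k) := ⟨by exact_mod_cast ha0⟩
    have : NeZero a := ⟨ha0⟩
    obtain ⟨ζ, hζ⟩ := HasEnoughRootsOfUnity.exists_primitiveRoot k a
    obtain ⟨h2, h3⟩ := hh ζ
    obtain ⟨h4, h5⟩ := hh 1
    have h6 := hinj ((h3.trans (by simp [hζ.pow_eq_one])).trans h5.symm)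
    rw [mk_eq_mk_iff_mul] at h6
    have : ζ = 1 := by simpa using h6
    rw [this] at hζ
    exact hζ.unique IsPrimitiveRoot.one
  subst ha
  refine ⟨diagEquiv (.mk0 c hc) (.mk0 d hd), fun p => ?_⟩
  induction p using Projectivization.ind with
  | h v hv =>
  rw [Projectivization.smul_mk]
  by_cases hv1 : v 1 = 0
  · have h2 : Projectivization.mk k v hv = Projectivization.mk k ![1, 0] vec_one_zero_ne_zero := by
      rw [mk_eq_mk_iff_mul]
      simp [hv1]
    rw [h2, h1, mk_eq_mk_iff_mul, LinearEquiv.smul_def, diagEquiv_apply]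
    simp [hv1]
  · have h2 : Projectivization.mk k v hv =
        Projectivization.mk k ![v 0 / v 1, 1] (vec_one_ne_zero _) := by
      rw [mk_eq_mk_iff_mul]
      simp [hv1, mul_div_cancel₀]
    obtain ⟨h3, h4⟩ := hh (v 0 / v 1)
    rw [h2, h4, mk_eq_mk_iff_mul, LinearEquiv.smul_def, diagEquiv_apply]
    simp
    field_simp

/-- A bijection of the projective line given by forms is projective linear. -/
theorem exists_smul_eq_of_isForms [IsAlgClosed k] [CharZero k] {h : P1 k → P1 k}
    {F : Fin 2 → MvPolynomial (Fin 2) k} {a : ℕ}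
    (hF : ProjVar.IsForms P1.weight (P1.coords k) h F a) (hbij : Function.Bijective h) :
    ∃ g : (Fin 2 → k) ≃ₗ[k] (Fin 2 → k), ∀ p, h p = g • p := by
  have hne : (Projectivization.mk k ![0, 1] vec_zero_one_ne_zero : P1 k) ≠
      Projectivization.mk k ![1, 0] vec_one_zero_ne_zero := by
    rw [Ne, mk_eq_mk_iff_mul]
    simp
  obtain ⟨p, hp⟩ := hbij.2 (Projectivization.mk k ![0, 1] vec_zero_one_ne_zero)
  obtain ⟨q, hq⟩ := hbij.2 (Projectivization.mk k ![1, 0] vec_one_zero_ne_zero)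
  have hpq : p ≠ q := by
    rintro rfl
    exact hne (hp.symm.trans hq)
  -- Precompose with a linear map that takes `0` and `∞` to their preimages under `h`, so that the
  -- composite fixes both.
  obtain ⟨g, hg0, hg1⟩ := MulAction.is_two_pretransitive_iff.mp
    (Projectivization.linearEquiv_is_two_pretransitive k (Fin 2 → k)) hne hpq
  obtain ⟨g', hg'⟩ := exists_diag_of_isForms (isForms_comp_smul hF g)
    (hbij.1.comp (MulAction.injective g)) (by rw [hg0, hp]) (by rw [hg1, hq])
  refine ⟨g' * g⁻¹, fun p => ?_⟩
  rw [mul_smul, ← hg', smul_inv_smul]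

theorem mem_PL_of_isForms [IsAlgClosed k] [CharZero k] {φ : Equiv.Perm (P1 k)}
    {F : Fin 2 → MvPolynomial (Fin 2) k} {a : ℕ}
    (hF : ProjVar.IsForms P1.weight (P1.coords k) φ F a) : φ ∈ PL k := by
  obtain ⟨g, hg⟩ := exists_smul_eq_of_isForms hF φ.bijective
  exact ⟨g, Equiv.ext fun p => (hg p).symm⟩

/-- Automorphisms of the projective line are projective linear. -/
theorem aut_le_PL [IsAlgClosed k] [CharZero k] : P1.Aut k ≤ PL k := by
  intro φ hφ
  obtain ⟨F, d, hF⟩ := (hφ.1.isLocallyForms id id rfl fun _ _ => rfl).exists_isForms isDense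
    fun _ _ _ => IsWeightedHomogeneous.of_mul_left
  exact mem_PL_of_isForms hF

end P1

/-! ### Automorphisms of the product of two lines -/

namespace ProjVar

open MvPolynomial

variable {k : Type*} [Field k] {X σ M : Type*} [AddCommMonoid M]

/-- A map given by a homogeneous substitution of the coordinates is a morphism. -/
theorem isMorphism_of_aeval {w : σ → M} {c : X → σ → k} {φ : X → X} (τ : M →+ M)
    (P : σ → MvPolynomial σ k) (hP : ∀ s, (P s).IsWeightedHomogeneous w (τ (w s)))
    (hφ : ∀ x d, ∃ u : k, u ≠ 0 ∧ ∀ F : MvPolynomial σ k, F.IsWeightedHomogeneous w d →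
      eval (c (φ x)) F = u * eval (c x) (aeval P F)) : IsMorphism w c φ := by
  have hopen : ∀ V, IsOpen[zariskiTopology w c] V → IsOpen[zariskiTopology w c] (φ ⁻¹' V) := by
    intro V hV
    change TopologicalSpace.GenerateOpen _ V at hV
    induction hV with
    | basic U hU =>
      obtain ⟨F, d, hF, rfl⟩ := hU
      convert isOpen_basicOpen (c := c) (hF.aeval τ P hP) using 1
      ext x
      obtain ⟨u, hu, h⟩ := hφ x d
      simp [h F hF, hu]
    | univ => exact TopologicalSpace.GenerateOpen.univ
    | inter U V _ _ hU hV => exact TopologicalSpace.GenerateOpen.inter _ _ hU hV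
    | sUnion S _ ih =>
      rw [Set.preimage_sUnion]
      exact @isOpen_biUnion _ _ (zariskiTopology w c) _ _ ih
  refine fun V hV => ⟨hopen V hV, fun f hf x hx => ?_⟩
  obtain ⟨U, hU, hxU, hUV, F, G, d, hF, hG, h⟩ := hf (φ x) hx
  refine ⟨φ ⁻¹' U, hopen U hU, hxU, Set.preimage_mono hUV, aeval P F, aeval P G, τ d,
    hF.aeval τ P hP, hG.aeval τ P hP, fun y hy => ?_⟩
  obtain ⟨h1, h2⟩ := h (φ y) hy
  obtain ⟨u, hu, h3⟩ := hφ y d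
  rw [h3 G hG] at h1
  refine ⟨right_ne_zero_of_mul h1, ?_⟩
  rw [Function.comp_apply, h2, h3 G hG, h3 F hF, mul_div_mul_left _ _ hu]

end ProjVar

namespace P1xP1

open MvPolynomial

variable {k : Type*} [Field k]

theorem isMorphism_prodMap_smul (g h : (Fin 2 → k) ≃ₗ[k] (Fin 2 → k)) :
    ProjVar.IsMorphism P1xP1.weight (P1xP1.coords k) fun x => (g • x.1, h • x.2) := by
  let P : Fin 2 ⊕ Fin 2 → MvPolynomial (Fin 2 ⊕ Fin 2) k :=
    Sum.elim (P1.linForm g.toLinearMap Sum.inl) (P1.linForm h.toLinearMap Sum.inr)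
  refine ProjVar.isMorphism_of_aeval (AddMonoidHom.id (ℕ × ℕ)) P ?_ fun x d => ?_
  · rintro (i | i)
    · exact P1.isWeightedHomogeneous_linForm (m := ((1, 0) : ℕ × ℕ)) g.toLinearMap Sum.inl
        (fun _ => rfl) i
    · exact P1.isWeightedHomogeneous_linForm (m := ((0, 1) : ℕ × ℕ)) h.toLinearMap Sum.inr
        (fun _ => rfl) i
  · have hrep : ∀ (g : (Fin 2 → k) ≃ₗ[k] (Fin 2 → k)) (p : P1 k),
        ∃ a : k, a ≠ 0 ∧ (g • p).rep = a • g p.rep := by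
      intro g p
      have := P1.exists_rep_mk ((LinearEquiv.map_ne_zero_iff g).mpr p.rep_nonzero)
      have h1 : g • p = Projectivization.mk k (g p.rep)
          ((LinearEquiv.map_ne_zero_iff g).mpr p.rep_nonzero) := by
        conv_lhs => rw [← p.mk_rep, Projectivization.smul_mk]
        rfl
      rwa [h1]
    obtain ⟨a, ha, hga⟩ := hrep g x.1
    obtain ⟨b, hb, hhb⟩ := hrep h x.2
    refine ⟨a ^ d.1 * b ^ d.2, mul_ne_zero (pow_ne_zero _ ha) (pow_ne_zero _ hb), fun F hF => ?_⟩
    rw [coords, hga, hhb, eval_smul_smul hF]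
    congr 1
    rw [← aeval_eq_eval, ← aeval_eq_eval, ← AlgHom.comp_apply, comp_aeval]
    congr 2
    ext s
    rcases s with s | s <;> simp only [P, aeval_eq_eval, Sum.elim_inl, Sum.elim_inr,
      P1.eval_linForm] <;> rfl

theorem isMorphism_swap : ProjVar.IsMorphism P1xP1.weight (P1xP1.coords k) Prod.swap := by
  refine ProjVar.isMorphism_of_aeval (AddEquiv.prodComm : ℕ × ℕ ≃+ ℕ × ℕ).toAddMonoidHom
    (fun s => X s.swap) ?_ fun x d => ⟨1, one_ne_zero, fun F _ => ?_⟩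
  · rintro (i | i)
    · exact isWeightedHomogeneous_X k P1xP1.weight (.inr i)
    · exact isWeightedHomogeneous_X k P1xP1.weight (.inl i)
  · rw [one_mul, ← aeval_eq_eval, ← aeval_eq_eval, ← AlgHom.comp_apply, comp_aeval]
    congr 2
    ext s
    rcases s with s | s <;> simp [coords]

/-- The interchange of the two factors. -/
def swapPerm : Equiv.Perm (P1xP1 k) := Equiv.prodComm _ _

theorem swapPerm_mem_aut : (swapPerm : Equiv.Perm (P1xP1 k)) ∈ P1xP1.Aut k :=
  ⟨isMorphism_swap, isMorphism_swap⟩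

theorem prodCongr_mem_aut {g h : Equiv.Perm (P1 k)} (hg : g ∈ P1.PL k) (hh : h ∈ P1.PL k) :
    (g.prodCongr h : Equiv.Perm (P1xP1 k)) ∈ P1xP1.Aut k := by
  obtain ⟨g, rfl⟩ := hg
  obtain ⟨h, rfl⟩ := hh
  exact ⟨isMorphism_prodMap_smul g h, isMorphism_prodMap_smul g⁻¹ h⁻¹⟩

/-- Automorphisms of `ℙ¹ × ℙ¹` are products of projective linear transformations, possibly
composed with the interchange of the factors. -/
theorem exists_of_mem_aut [IsAlgClosed k] [CharZero k] {φ : Equiv.Perm (P1xP1 k)}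
    (hφ : φ ∈ P1xP1.Aut k) : ∃ g ∈ P1.PL k, ∃ h ∈ P1.PL k,
      (∀ x, φ x = (g x.1, h x.2)) ∨ ∀ x, φ x = (g x.2, h x.1) := by
  have hne : ∃ p q : P1 k, p ≠ q := by
    refine ⟨Projectivization.mk k ![0, 1] P1.vec_zero_one_ne_zero,
      Projectivization.mk k ![1, 0] P1.vec_one_zero_ne_zero, ?_⟩
    rw [Ne, P1.mk_eq_mk_iff_mul]
    simp
  obtain ⟨p, q, hpq⟩ := hne
  have : Nonempty (P1xP1 k) := ⟨(p, q)⟩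
  obtain ⟨F₁, d₁, hF₁⟩ := (hφ.1.isLocallyForms Prod.fst Sum.inl rfl
    fun _ _ => rfl).exists_isForms isDense fun _ _ _ => IsWeightedHomogeneous.of_mul_left_prod
  obtain ⟨F₂, d₂, hF₂⟩ := (hφ.1.isLocallyForms Prod.snd Sum.inr rfl
    fun _ _ => rfl).exists_isForms isDense fun _ _ _ => IsWeightedHomogeneous.of_mul_left_prod
  obtain ⟨g, H₁, e₁, hH₁, hg⟩ := exists_factorization_of_isForms hF₁
  obtain ⟨h, H₂, e₂, hH₂, hh⟩ := exists_factorization_of_isForms hF₂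
  simp only [Function.comp_apply] at hg hh
  have bij : ∀ (ψ : P1xP1 k → P1xP1 k), Function.Bijective ψ → (∀ x, ψ x = (g x.1, h x.2)) →
      Function.Bijective g ∧ Function.Bijective h := by
    intro ψ hψ e
    refine ⟨⟨fun a b hab => ?_, fun b => ?_⟩, ⟨fun a b hab => ?_, fun b => ?_⟩⟩
    · exact congrArg Prod.fst (hψ.1 (a₁ := (a, p)) (a₂ := (b, p)) (by simp [e, hab]))
    · obtain ⟨x, hx⟩ := hψ.2 (b, p)
      exact ⟨x.1, by rw [e] at hx; exact congrArg Prod.fst hx⟩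
    · exact congrArg Prod.snd (hψ.1 (a₁ := (p, a)) (a₂ := (p, b)) (by simp [e, hab]))
    · obtain ⟨x, hx⟩ := hψ.2 (p, b)
      exact ⟨x.2, by rw [e] at hx; exact congrArg Prod.snd hx⟩
  have conclude : Function.Bijective g → Function.Bijective h →
      ∃ g' ∈ P1.PL k, ∃ h' ∈ P1.PL k, (∀ x, g' x = g x) ∧ ∀ x, h' x = h x := fun hg hh =>
    ⟨Equiv.ofBijective g hg, P1.mem_PL_of_isForms hH₁, Equiv.ofBijective h hh,
      P1.mem_PL_of_isForms hH₂, fun _ => rfl, fun _ => rfl⟩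
  -- If both components used the same coordinate, the map would not be injective. In the crossed
  -- case, precomposing with the interchange reduces to a product map.
  rcases hg with hg | hg <;> rcases hh with hh | hh
  · refine absurd (congrArg Prod.snd (φ.injective (a₁ := (p, p)) (a₂ := (p, q)) ?_)) hpq
    ext1 <;> simp [hg, hh]
  · obtain ⟨h1, h2⟩ := bij φ φ.bijective fun x => Prod.ext (hg x) (hh x)
    obtain ⟨g', hg', h', hh', h3, h4⟩ := conclude h1 h2
    exact ⟨g', hg', h', hh', .inl fun x => Prod.ext (by rw [hg, h3]) (by rw [hh, h4])⟩
  · obtain ⟨h1, h2⟩ := bij (φ ∘ Prod.swap) (φ.bijective.comp Prod.swap_bijective)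
      fun x => Prod.ext (hg _) (hh _)
    obtain ⟨g', hg', h', hh', h3, h4⟩ := conclude h1 h2
    exact ⟨g', hg', h', hh', .inr fun x => Prod.ext (by rw [hg, h3]) (by rw [hh, h4])⟩
  · refine absurd (congrArg Prod.fst (φ.injective (a₁ := (p, p)) (a₂ := (q, p)) ?_)) hpq
    ext1 <;> simp [hg, hh]

end P1xP1

/-! ### Orbit counting: a short orbit exists -/

section OrbitCounting

/-- Writing the sizes as `n / r`, the relation is `1 / r₁ + 1 / r₂ + 1 / r₃ = 1 + 2 / n` with `r₁ =
2`. The solutions are the dihedral, tetrahedral, octahedral and icosahedral ones, with smallest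
orbits of `2`, `4`, `6` and `12` points. The icosahedral case is why the threshold is `13`. -/
theorem false_of_three_orbit_sizes {a b c n : ℕ} (ha : 13 ≤ a) (hb : 13 ≤ b) (hc : 13 ≤ c)
    (h : a + b + c = n + 2) (ha' : 2 * a = n)
    (hb' : 2 * b = n ∨ 3 * b = n ∨ 4 * b = n ∨ 5 * b = n ∨ 6 * b ≤ n)
    (hc' : 2 * c = n ∨ 3 * c = n ∨ 4 * c = n ∨ 5 * c = n ∨ 6 * c ≤ n) : False := by
  subst ha'
  have h1 : b + c = a + 2 := by omega
  clear h
  rcases hb' with hb' | hb' | hb' | hb' | hb' <;>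
    rcases hc' with hc' | hc' | hc' | hc' | hc' <;> omega

/-- The arithmetic of the orbit sizes of a finite group in which every nontrivial element has exactly
two fixed points. -/
theorem false_of_orbit_sizes {N n : ℕ} (s : Fin N → ℕ) (hn : 2 ≤ n) (hs : ∀ i, 13 ≤ s i)
    (hr : ∀ i, ∃ r, 2 ≤ r ∧ s i * r = n) (h : ∑ i, s i + 2 * (n - 1) = N * n) : False := by
  have h2 : ∀ i, 2 * s i ≤ n := fun i => by
    obtain ⟨r, hr2, hr⟩ := hr i
    rw [← hr, mul_comm]
    exact Nat.mul_le_mul_left _ hr2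
  have h3 : 2 * ∑ i, s i ≤ N * n := by
    rw [Finset.mul_sum]
    exact (Finset.sum_le_sum fun i _ => h2 i).trans (by simp)
  -- Each orbit has at most `n / 2` points, so `2 * (n - 1) ≥ N * n / 2`.
  have hN : N < 4 := by
    by_contra! hN
    have := Nat.mul_le_mul_right n hN
    omega
  have hcase : ∀ i, 2 * s i = n ∨ 3 * s i = n ∨ 4 * s i = n ∨ 5 * s i = n ∨ 6 * s i ≤ n := by
    intro i
    obtain ⟨r, hr2, hr⟩ := hr i
    by_cases h6 : 6 ≤ r
    · have := Nat.mul_le_mul_left (s i) h6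
      omega
    · interval_cases r <;> omega
  interval_cases N
  · simp at h
    omega
  · simp at h
    have := hs 0
    omega
  · rw [Fin.sum_univ_two] at h
    have := hs 0
    have := hs 1
    omega
  · rw [Fin.sum_univ_three] at h
    have := hs 0
    have := hs 1
    have := hs 2
    -- Otherwise each size is at most `n / 3`, and the sum cannot be `n + 2`.
    have hhalf : 2 * s 0 = n ∨ 2 * s 1 = n ∨ 2 * s 2 = n := by
      by_contra! hne
      have h3 : ∀ i, 2 * s i ≠ n → 3 * s i ≤ n := fun i hi => by
        rcases hcase i with h | h | h | h | h <;> omega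
      have := h3 0 hne.1
      have := h3 1 hne.2.1
      have := h3 2 hne.2.2
      omega
    rcases hhalf with h0 | h0 | h0
    · exact false_of_three_orbit_sizes (hs 0) (hs 1) (hs 2) (by omega) h0 (hcase 1) (hcase 2)
    · exact false_of_three_orbit_sizes (hs 1) (hs 0) (hs 2) (by omega) h0 (hcase 0) (hcase 2)
    · exact false_of_three_orbit_sizes (hs 2) (hs 0) (hs 1) (by omega) h0 (hcase 0) (hcase 1)

/-- A finite group acting such that every nontrivial element has exactly two fixed points has an
orbit with at most `12` elements. -/
theorem exists_ncard_orbit_le_twelve {G X : Type*} [Group G] [Finite G] [MulAction G X] [Nonempty X]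
    (hfix : ∀ g : G, g ≠ 1 → (MulAction.fixedBy X g).ncard = 2) :
    ∃ x : X, (MulAction.orbit G x).ncard ≤ 12 := by
  by_contra! hbig
  -- The points with nontrivial stabilizer form a finite invariant set, so Burnside's lemma applies:
  -- the identity fixes all of `S` and every other element fixes two points.
  let S : SubMulAction G X :=
    { carrier := {x | ∃ g : G, g ≠ 1 ∧ g • x = x}
      smul_mem' := by
        rintro h x ⟨g, hg, hgx⟩
        refine ⟨h * g * h⁻¹, by simpa using hg, ?_⟩
        rw [mul_smul, mul_smul, inv_smul_smul, hgx] }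
  have hfixfin : ∀ g : G, g ≠ 1 → (MulAction.fixedBy X g).Finite := fun g hg =>
    Set.finite_of_ncard_ne_zero (by rw [hfix g hg]; decide)
  have hSfin : (S : Set X).Finite := by
    have : (S : Set X) ⊆ ⋃ g : {g : G // g ≠ 1}, MulAction.fixedBy X g.1 := by
      rintro x ⟨g, hg, hgx⟩
      exact Set.mem_iUnion.mpr ⟨⟨g, hg⟩, hgx⟩
    exact (Set.finite_iUnion fun g : {g : G // g ≠ 1} => hfixfin g.1 g.2).subset this
  have : Finite S := hSfin
  classical
  have := Fintype.ofFinite G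
  have := Fintype.ofFinite S
  let Ω := MulAction.orbitRel.Quotient G S
  have := Fintype.ofFinite Ω
  have hn : 2 ≤ Fintype.card G := by
    obtain ⟨x⟩ := ‹Nonempty X›
    have h1 := hbig x
    rw [← MulAction.index_stabilizer] at h1
    have h2 := (MulAction.stabilizer G x).index_mul_card
    have h3 : 0 < Nat.card (MulAction.stabilizer G x) := Nat.card_pos
    rw [Nat.card_eq_fintype_card (α := G)] at h2
    nlinarith
  have hburn := MulAction.sum_card_fixedBy_eq_card_orbits_mul_card_group G S
  have hcard : ∀ g : G, g ≠ 1 → Fintype.card (MulAction.fixedBy S g) = 2 := by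
    intro g hg
    rw [← Nat.card_eq_fintype_card, Nat.card_coe_set_eq, ← hfix g hg,
      ← Set.ncard_image_of_injective _ Subtype.val_injective]
    congr 1
    ext x
    simp only [Set.mem_image, MulAction.mem_fixedBy]
    constructor
    · rintro ⟨y, hy, rfl⟩
      exact congrArg Subtype.val hy
    · intro hx
      exact ⟨⟨x, g, hg, hx⟩, Subtype.ext hx, rfl⟩
  have hcard1 : Fintype.card (MulAction.fixedBy S (1 : G)) = Fintype.card S := by
    rw [← Nat.card_eq_fintype_card, Nat.card_coe_set_eq, MulAction.fixedBy_one_eq_univ,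
      Set.ncard_univ, Nat.card_eq_fintype_card]
  rw [← Finset.add_sum_erase _ _ (Finset.mem_univ 1), hcard1,
    Finset.sum_congr rfl (fun g hg => hcard g (Finset.ne_of_mem_erase hg)), Finset.sum_const,
    Finset.card_erase_of_mem (Finset.mem_univ _), Finset.card_univ, smul_eq_mul] at hburn
  have hsum : Fintype.card S = ∑ ω : Ω, ω.orbit.ncard := by
    rw [Fintype.card_congr (MulAction.selfEquivSigmaOrbits' G S), Fintype.card_sigma]
    refine Finset.sum_congr rfl fun ω _ => ?_
    rw [← Nat.card_eq_fintype_card, Nat.card_coe_set_eq]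
  let e := Fintype.equivFin Ω
  have horb : ∀ ω : Ω, ∃ x : S, ω.orbit = MulAction.orbit G x := fun ω => by
    refine ⟨ω.out, ?_⟩
    rw [MulAction.orbitRel.Quotient.orbit_eq_orbit_out _ Quotient.out_eq']
  refine false_of_orbit_sizes (N := Fintype.card Ω) (n := Fintype.card G)
    (fun i => (e.symm i).orbit.ncard) hn (fun i => ?_) (fun i => ?_) ?_
  · obtain ⟨x, hx⟩ := horb (e.symm i)
    rw [hx, ← Set.ncard_image_of_injective _ Subtype.val_injective, SubMulAction.val_image_orbit]
    exact hbig _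
  · obtain ⟨x, hx⟩ := horb (e.symm i)
    refine ⟨Nat.card (MulAction.stabilizer G x), ?_, ?_⟩
    · obtain ⟨g, hg, hgx⟩ := x.2
      have hnt : Nontrivial (MulAction.stabilizer G x) :=
        ⟨⟨⟨g, Subtype.ext hgx⟩, 1, fun h => hg (congrArg Subtype.val h)⟩⟩
      exact Finite.one_lt_card
    · rw [hx, ← MulAction.index_stabilizer, Subgroup.index_mul_card, Nat.card_eq_fintype_card]
  · rw [e.symm.sum_comp fun ω : Ω => ω.orbit.ncard, ← hsum, ← hburn, mul_comm 2]

end OrbitCounting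
-- Projectivities of finite order: fixed points and commutation
open scoped commutatorElement

namespace P1

variable {k : Type*} [Field k]

/-- The area form `v₀ w₁ - v₁ w₀`. -/
def area (v w : Fin 2 → k) : k := v 0 * w 1 - v 1 * w 0

theorem area_add (v w w' : Fin 2 → k) : area v (w + w') = area v w + area v w' := by
  simp only [area, Pi.add_apply]
  ring

theorem area_smul (v w : Fin 2 → k) (a : k) : area v (a • w) = a * area v w := by
  simp only [area, Pi.smul_apply, smul_eq_mul]
  ring

theorem area_self (v : Fin 2 → k) : area v v = 0 := by
  simp only [area]
  ring

theorem exists_area_eq_one {v : Fin 2 → k} (hv : v ≠ 0) : ∃ u, area v u = 1 := by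
  obtain ⟨i, hi⟩ := Function.ne_iff.mp hv
  fin_cases i
  · exact ⟨![0, (v 0)⁻¹], by simpa [area] using mul_inv_cancel₀ hi⟩
  · exact ⟨![-(v 1)⁻¹, 0], by simpa [area] using mul_inv_cancel₀ hi⟩

theorem exists_smul_eq_of_area_eq_zero {v w : Fin 2 → k} (hv : v ≠ 0) (h : area v w = 0) :
    ∃ b : k, w = b • v := by
  by_cases hw : w = 0
  · exact ⟨0, by simp [hw]⟩
  · have h1 := (mk_eq_mk_iff_mul hw hv).mpr (by
      simp only [area] at h
      linear_combination -h)
    rw [Projectivization.mk_eq_mk_iff'] at h1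
    obtain ⟨b, hb⟩ := h1
    exact ⟨b, hb.symm⟩

/-- If `v` and `u` are not proportional, they span the plane. -/
theorem exists_eq_add {v u : Fin 2 → k} (hv : v ≠ 0) (hu : area v u ≠ 0) (w : Fin 2 → k) :
    ∃ a b : k, w = a • v + b • u := by
  obtain ⟨a, ha⟩ := exists_smul_eq_of_area_eq_zero (w := w + (-(area v w / area v u)) • u) hv
    (by rw [area_add, area_smul]; field_simp; ring)
  exact ⟨a, area v w / area v u, by rw [← ha]; module⟩

variable (L : (Fin 2 → k) ≃ₗ[k] (Fin 2 → k))

theorem smul_mk_eq_iff {v : Fin 2 → k} (hv : v ≠ 0) :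
    L • (Projectivization.mk k v hv : P1 k) = Projectivization.mk k v hv ↔ ∃ a : k, L v = a • v := by
  rw [Projectivization.smul_mk, Projectivization.mk_eq_mk_iff']
  exact ⟨fun ⟨a, ha⟩ => ⟨a, ha.symm⟩, fun ⟨a, ha⟩ => ⟨a, ha.symm⟩⟩

/-- The action of a linear map with eigenvector `v` on the quotient of the plane by `v`. -/
theorem exists_area_map {L : (Fin 2 → k) ≃ₗ[k] (Fin 2 → k)} {v : Fin 2 → k} (hv : v ≠ 0) {a : k}
    (ha : L v = a • v) : ∃ d, ∀ w, area v (L w) = d * area v w := by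
  obtain ⟨u, hu⟩ := exists_area_eq_one hv
  refine ⟨area v (L u), fun w => ?_⟩
  obtain ⟨x, y, rfl⟩ := exists_eq_add hv (by rw [hu]; exact one_ne_zero) w
  simp only [map_add, map_smul, ha, area_add, area_smul, area_self, hu]
  ring

/-- A linear map that fixes all points of the projective line is a scalar. -/
theorem exists_eq_smul_of_forall_smul_eq {L : (Fin 2 → k) ≃ₗ[k] (Fin 2 → k)}
    (h : ∀ p : P1 k, L • p = p) : ∃ a : k, ∀ w, L w = a • w := by
  have key : ∀ v : Fin 2 → k, v ≠ 0 → ∃ a : k, L v = a • v := fun v hv =>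
    (smul_mk_eq_iff L hv).mp (h _)
  obtain ⟨a, ha⟩ := key ![1, 0] vec_one_zero_ne_zero
  obtain ⟨b, hb⟩ := key ![0, 1] vec_zero_one_ne_zero
  obtain ⟨c, hc⟩ := key ![1, 1] (vec_one_ne_zero 1)
  have h1 : (![1, 1] : Fin 2 → k) = ![1, 0] + ![0, 1] := by ext i; fin_cases i <;> simp
  rw [h1, map_add, ha, hb] at hc
  have h2 := congrFun hc 0
  have h3 := congrFun hc 1
  simp at h2 h3
  refine ⟨a, fun w => ?_⟩
  have h4 : w = w 0 • ![1, 0] + w 1 • ![0, 1] := by ext i; fin_cases i <;> simp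
  rw [h4, map_add, map_smul, map_smul, ha, hb, h2, h3]
  module

theorem toPerm_eq_one_of_forall {L : (Fin 2 → k) ≃ₗ[k] (Fin 2 → k)} {a : k}
    (h : ∀ w, L w = a • w) : (MulAction.toPerm L : Equiv.Perm (P1 k)) = 1 := by
  ext1 p
  induction p using Projectivization.ind with
  | h v hv => exact (smul_mk_eq_iff L hv).mpr ⟨a, h v⟩

theorem toPerm_pow (n : ℕ) :
    (MulAction.toPerm L : Equiv.Perm (P1 k)) ^ n = MulAction.toPerm (L ^ n) :=
  (map_pow (MulAction.toPermHom ((Fin 2 → k) ≃ₗ[k] (Fin 2 → k)) (P1 k)) L n).symm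

/-- A nontrivial projective linear transformation of finite order is diagonalizable. -/
theorem exists_eigenvector [CharZero k] {L : (Fin 2 → k) ≃ₗ[k] (Fin 2 → k)} {v : Fin 2 → k}
    (hv : v ≠ 0) {a : k} (ha : L v = a • v)
    (hfin : IsOfFinOrder (MulAction.toPerm L : Equiv.Perm (P1 k)))
    (hne : (MulAction.toPerm L : Equiv.Perm (P1 k)) ≠ 1) :
    ∃ u d, area v u ≠ 0 ∧ L u = d • u ∧ d ≠ a := by
  obtain ⟨d, hd⟩ := exists_area_map hv ha
  obtain ⟨u, hu⟩ := exists_area_eq_one hv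
  have hu0 : area v u ≠ 0 := by rw [hu]; exact one_ne_zero
  obtain ⟨b, hb⟩ := exists_smul_eq_of_area_eq_zero (w := L u + (-d) • u) hv (by
    rw [area_add, area_smul, hd]; ring)
  have hLu : L u = d • u + b • v := by rw [← hb]; module
  have ha0 : a ≠ 0 := by
    rintro rfl
    rw [zero_smul, LinearEquiv.map_eq_zero_iff] at ha
    exact hv ha
  by_cases hda : d = a
  · exfalso
    subst hda
    obtain ⟨n, hn, hn1⟩ := isOfFinOrder_iff_pow_eq_one.mp hfin
    rw [toPerm_pow] at hn1
    obtain ⟨m, hm⟩ := exists_eq_smul_of_forall_smul_eq (L := L ^ n)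
      fun p => congrArg (fun σ : Equiv.Perm (P1 k) => σ p) hn1
    -- A Jordan block has infinite order in characteristic zero: if a power `n + 1` is scalar, then
    -- `(n + 1) * d ^ n * b = 0`, so `b = 0` and `L` is already scalar.
    have hpow : ∀ n : ℕ, (L ^ (n + 1)) u = d ^ (n + 1) • u + ((n + 1) * d ^ n * b) • v := by
      intro n
      induction n with
      | zero => simpa using hLu
      | succ n ih =>
        rw [pow_succ', LinearEquiv.mul_apply, ih, map_add, map_smul, map_smul, hLu, ha]
        push_cast
        module
    obtain ⟨n, rfl⟩ : ∃ n', n = n' + 1 := ⟨n - 1, by omega⟩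
    have h1 := hpow n
    rw [hm] at h1
    have h2 := congrArg (area v) h1
    rw [area_add, area_smul, area_smul, area_smul, area_self, hu] at h2
    have h3 : m = d ^ (n + 1) := by simpa using h2
    rw [h3] at h1
    have h4 : ((n + 1) * d ^ n * b) • v = 0 := by simpa using h1
    rcases smul_eq_zero.mp h4 with h4 | h4
    · have hn0 : (n : k) + 1 ≠ 0 := by exact_mod_cast Nat.succ_ne_zero n
      have hb0 : b = 0 := (mul_eq_zero.mp h4).resolve_left (mul_ne_zero hn0 (pow_ne_zero _ ha0))
      refine hne (toPerm_eq_one_of_forall (a := d) fun w => ?_)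
      obtain ⟨x, y, rfl⟩ := exists_eq_add hv hu0 w
      rw [map_add, map_smul, map_smul, ha, hLu, hb0]
      module
    · exact hv h4
  -- The correction `x • v` of `u` must satisfy `b + x * a = d * x`.
  · refine ⟨u + (b / (d - a)) • v, d, ?_, ?_, hda⟩
    · rw [area_add, area_smul, area_self, mul_zero, add_zero]
      exact hu0
    · have : d - a ≠ 0 := sub_ne_zero.mpr hda
      rw [map_add, map_smul, hLu, ha]
      have h5 : b = b / (d - a) * (d - a) := by field_simp
      generalize b / (d - a) = c at h5 ⊢
      rw [h5]
      module

/-- A nontrivial projective linear transformation of finite order has exactly two fixed points. -/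
theorem ncard_fixedPoints [IsAlgClosed k] [CharZero k] {g : Equiv.Perm (P1 k)} (hg : g ∈ PL k)
    (hfin : IsOfFinOrder g) (hne : g ≠ 1) : {p | g p = p}.ncard = 2 := by
  obtain ⟨L, rfl⟩ := hg
  obtain ⟨a, ha⟩ := Module.End.exists_eigenvalue (K := k) (V := Fin 2 → k) L.toLinearMap
  obtain ⟨v, hv⟩ := ha.exists_hasEigenvector
  have hLv : L v = a • v := hv.apply_eq_smul
  have hv0 : v ≠ 0 := hv.2
  obtain ⟨u, d, hu, hLu, hda⟩ := exists_eigenvector hv0 hLv hfin hne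
  have hu0 : u ≠ 0 := by
    rintro rfl
    simp [area] at hu
  rw [Set.ncard_eq_two]
  refine ⟨Projectivization.mk k v hv0, Projectivization.mk k u hu0, ?_, ?_⟩
  · rw [Ne, mk_eq_mk_iff_mul]
    intro h
    exact hu (sub_eq_zero.mpr h)
  · ext p
    simp only [Set.mem_ofPred_eq, Set.mem_insert_iff, Set.mem_singleton_iff]
    constructor
    · intro hp
      induction p using Projectivization.ind with
      | h w hw =>
      obtain ⟨c, hc⟩ := (smul_mk_eq_iff L hw).mp hp
      obtain ⟨x, y, rfl⟩ := exists_eq_add hv0 hu w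
      have h1 := congrArg (area v) hc
      have h2 : (x * (a - c)) • v = (y * (c - d)) • u := by
        rw [map_add, map_smul, map_smul, hLv, hLu] at hc
        rw [← sub_eq_zero] at hc ⊢
        rw [← hc]
        module
      simp only [map_add, map_smul, hLv, hLu, area_add, area_smul, area_self] at h1
      have h3 : y * (d - c) = 0 := by
        have : (y * (d - c)) * area v u = 0 := by linear_combination h1
        exact (mul_eq_zero.mp this).resolve_right hu
      have h4 : x * (a - c) = 0 := by
        rw [show y * (c - d) = 0 by linear_combination -h3, zero_smul] at h2
        exact (smul_eq_zero.mp h2).resolve_right hv0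
      rcases mul_eq_zero.mp h3 with h5 | h5
      · left
        rw [Projectivization.mk_eq_mk_iff']
        exact ⟨x, by simp [h5]⟩
      · right
        have hac : a - c ≠ 0 := fun h => hda (by linear_combination h5 - h)
        rw [Projectivization.mk_eq_mk_iff']
        exact ⟨y, by simp [(mul_eq_zero.mp h4).resolve_right hac]⟩
    · rintro (rfl | rfl)
      · exact (smul_mk_eq_iff L hv0).mpr ⟨a, hLv⟩
      · exact (smul_mk_eq_iff L hu0).mpr ⟨d, hLu⟩

/-- Two projective linear transformations with a common fixed point commute if their commutator has
finite order. -/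
theorem mul_comm_of_fixed [CharZero k] {g h : Equiv.Perm (P1 k)} (hg : g ∈ PL k) (hh : h ∈ PL k)
    (hfin : IsOfFinOrder ⁅g, h⁆) {p : P1 k} (hgp : g p = p) (hhp : h p = p) : g * h = h * g := by
  rw [← commutatorElement_eq_one_iff_mul_comm]
  by_contra hne
  obtain ⟨L, rfl⟩ := hg
  obtain ⟨K, rfl⟩ := hh
  rw [← map_commutatorElement] at hfin hne
  induction p using Projectivization.ind with
  | h v hv =>
  obtain ⟨a, ha⟩ := (smul_mk_eq_iff L hv).mp hgp
  obtain ⟨b, hb⟩ := (smul_mk_eq_iff K hv).mp hhp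
  have hinv : ∀ (L : (Fin 2 → k) ≃ₗ[k] (Fin 2 → k)) (a : k), L v = a • v →
      a ≠ 0 ∧ L⁻¹ v = a⁻¹ • v := by
    intro L a ha
    have ha0 : a ≠ 0 := by
      rintro rfl
      rw [zero_smul, LinearEquiv.map_eq_zero_iff] at ha
      exact hv ha
    refine ⟨ha0, L.injective ?_⟩
    rw [map_smul, ha, smul_smul, inv_mul_cancel₀ ha0, one_smul, ← LinearEquiv.mul_apply,
      mul_inv_cancel, LinearEquiv.coe_one, id]
  have hquot : ∀ (L : (Fin 2 → k) ≃ₗ[k] (Fin 2 → k)) (a : k), L v = a • v →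
      ∃ d, d ≠ 0 ∧ (∀ w, area v (L w) = d * area v w) ∧
        ∀ w, area v (L⁻¹ w) = d⁻¹ * area v w := by
    intro L a ha
    obtain ⟨d, hd⟩ := exists_area_map hv ha
    have h1 : ∀ w, area v w = d * area v (L⁻¹ w) := fun w => by
      rw [← hd, ← LinearEquiv.mul_apply, mul_inv_cancel, LinearEquiv.coe_one, id]
    have hd0 : d ≠ 0 := by
      rintro rfl
      obtain ⟨u, hu⟩ := exists_area_eq_one hv
      rw [h1, zero_mul] at hu
      exact zero_ne_one hu
    exact ⟨d, hd0, hd, fun w => by rw [h1 w, inv_mul_cancel_left₀ hd0]⟩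
  obtain ⟨ha0, ha'⟩ := hinv L a ha
  obtain ⟨hb0, hb'⟩ := hinv K b hb
  obtain ⟨c, hc0, hc, hc'⟩ := hquot L a ha
  obtain ⟨d, hd0, hd, hd'⟩ := hquot K b hb
  have h1 : ⁅L, K⁆ v = (1 : k) • v := by
    rw [commutatorElement_def]
    simp only [LinearEquiv.mul_apply, ha, hb, ha', hb', map_smul, smul_smul]
    congr 1
    field_simp
  -- The commutator fixes `v` and acts trivially on the quotient by `v`, so its second eigenvalue
  -- `e` would have to be `1` as well.
  obtain ⟨u, e, hu, hue, he⟩ := exists_eigenvector hv h1 hfin hne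
  have h2 : area v (⁅L, K⁆ u) = area v u := by
    rw [commutatorElement_def]
    simp only [LinearEquiv.mul_apply, hc, hd, hc', hd']
    field_simp
  rw [hue, area_smul] at h2
  exact he (mul_right_cancel₀ hu (h2.trans (one_mul _).symm))

/-- A finite group of projective linear transformations has a point with an orbit of at most `12`
elements, and the stabilizer of this point is abelian. -/
theorem exists_point_of_finite [IsAlgClosed k] [CharZero k] (G : Subgroup (Equiv.Perm (P1 k)))
    [Finite G] (hG : G ≤ PL k) : ∃ p : P1 k, (MulAction.orbit G p).ncard ≤ 12 ∧
      ∀ g ∈ G, ∀ h ∈ G, g p = p → h p = p → g * h = h * g := by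
  have hord : ∀ g ∈ G, IsOfFinOrder g := fun g hg =>
    G.subtype.isOfFinOrder (isOfFinOrder_of_finite (⟨g, hg⟩ : G))
  obtain ⟨p, hp⟩ := exists_ncard_orbit_le_twelve (G := G) (X := P1 k) fun g hg =>
    ncard_fixedPoints (hG g.2) (hord _ g.2) fun h => hg (Subtype.ext h)
  exact ⟨p, hp, fun g hg h hh hgp hhp => mul_comm_of_fixed (hG hg) (hG hh)
    (hord _ (G.mul_mem (G.mul_mem (G.mul_mem hg hh) (G.inv_mem hg)) (G.inv_mem hh))) hgp hhp⟩

end P1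

/-! ### Upper bounds for indices of abelian subgroups -/

section Jordan

theorem Subgroup.index_le_two_of_mul_mem {G : Type*} [Group G] (H : Subgroup G)
    (h : ∀ a b, a ∉ H → b ∉ H → a * b ∈ H) : H.index ≤ 2 := by
  by_cases hH : ∀ a, a ∈ H
  · rw [(Subgroup.eq_top_iff' H).mpr hH, Subgroup.index_top]
    norm_num
  · push Not at hH
    obtain ⟨a, ha⟩ := hH
    refine (Subgroup.index_eq_two_iff.mpr ⟨a, fun b => ?_⟩).le
    by_cases hb : b ∈ H
    · exact .inr ⟨hb, fun h' => ha ((H.mul_mem_cancel_left hb).mp h')⟩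
    · exact .inl ⟨h b a hb ha, hb⟩

/-- The normal core of an abelian subgroup of bounded index is a normal abelian subgroup of bounded
index. -/
theorem IsWeakJordanBound.isJordanBound {Γ : Type*} [Group Γ] {J : ℕ} (h : IsWeakJordanBound Γ J) :
    IsJordanBound Γ J.factorial := by
  intro G hG
  obtain ⟨A, hA, hJ⟩ := h G hG
  refine ⟨A.normalCore, A.normalCore_normal, fun a ha b hb =>
    hA a (A.normalCore_le ha) b (A.normalCore_le hb), ?_⟩
  refine (Nat.le_of_dvd (Nat.factorial_pos _) ?_).trans (Nat.factorial_le hJ)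
  -- The core is the kernel of the action on the cosets of `A`, so its index divides the factorial
  -- of the index of `A`.
  rw [Subgroup.normalCore_eq_ker, Subgroup.index_ker, Subgroup.index_eq_card, ← Nat.card_perm]
  exact Subgroup.card_subgroup_dvd_card _

end Jordan

namespace P1

variable {k : Type*} [Field k]

/-- The subgroup is the stabilizer of a point with a short orbit; its index is the length of the
orbit. -/
theorem exists_abelian_of_finite_aut [IsAlgClosed k] [CharZero k] (G : Subgroup (P1.Aut k))
    (hG : Finite G) :
    ∃ A : Subgroup G, (∀ a ∈ A, ∀ b ∈ A, a * b = b * a) ∧ A.index ≤ 12 ∧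
      ∃ p : P1 k, ∀ a ∈ A, (a : Equiv.Perm (P1 k)) p = p := by
  let H : Subgroup (Equiv.Perm (P1 k)) := G.map (P1.Aut k).subtype
  have hH : Finite H := Set.Finite.image _ (Set.toFinite (G : Set (P1.Aut k)))
  have hPL : H ≤ PL k := by
    rintro _ ⟨g, -, rfl⟩
    exact aut_le_PL g.2
  obtain ⟨p, hp, hcomm⟩ := exists_point_of_finite H hPL
  refine ⟨MulAction.stabilizer G p, fun a ha b hb => ?_, ?_, p, fun a ha => ha⟩
  · exact Subtype.ext (Subtype.ext (hcomm _ ⟨a, a.2, rfl⟩ _ ⟨b, b.2, rfl⟩ ha hb))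
  · rw [MulAction.index_stabilizer]
    refine (Set.ncard_le_ncard ?_ (Set.finite_range _)).trans hp
    rintro _ ⟨g, rfl⟩
    exact ⟨⟨_, g, g.2, rfl⟩, rfl⟩

end P1

namespace P1xP1

variable {k : Type*} [Field k]

variable (k) in
/-- The action of pairs of permutations of the projective line on the product. -/
def prodHom : Equiv.Perm (P1 k) × Equiv.Perm (P1 k) →* Equiv.Perm (P1xP1 k) where
  toFun p := p.1.prodCongr p.2
  map_one' := rfl
  map_mul' _ _ := rfl

theorem prodHom_injective : Function.Injective (prodHom k) := by
  rintro ⟨g, h⟩ ⟨g', h'⟩ e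
  have e' : ∀ p q, (g p, h q) = (g' p, h' q) := fun p q =>
    congrArg (fun σ : Equiv.Perm (P1xP1 k) => σ (p, q)) e
  obtain ⟨p⟩ : Nonempty (P1 k) := inferInstance
  exact Prod.ext (Equiv.ext fun q => congrArg Prod.fst (e' q p))
    (Equiv.ext fun q => congrArg Prod.snd (e' p q))

theorem preservesRulings_prodHom (g h : Equiv.Perm (P1 k)) :
    PreservesRulings (prodHom k (g, h)) := by
  constructor
  · rintro _ ⟨a, rfl⟩
    refine ⟨g a, Set.ext fun x => ⟨?_, fun hx => ?_⟩⟩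
    · rintro ⟨y, rfl, rfl⟩
      rfl
    · exact ⟨(a, h.symm x.2), rfl, Prod.ext hx.symm (h.apply_symm_apply _)⟩
  · rintro _ ⟨b, rfl⟩
    refine ⟨h b, Set.ext fun x => ⟨?_, fun hx => ?_⟩⟩
    · rintro ⟨y, rfl, rfl⟩
      rfl
    · exact ⟨(g.symm x.1, b), rfl, Prod.ext (g.apply_symm_apply _) hx.symm⟩

/-- The subgroup is the stabilizer of `(p₁, p₂)` among the elements that preserve the factors, where
`p₁` and `p₂` have short orbits under the two projections of these elements. It is abelian because
both components commute. -/
theorem exists_abelian_of_finite_aut [IsAlgClosed k] [CharZero k] (G : Subgroup (P1xP1.Aut k))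
    (hG : Finite G) :
    ∃ A : Subgroup G, (∀ a ∈ A, ∀ b ∈ A, a * b = b * a) ∧ A.index ≤ 288 ∧
      (∃ x : P1xP1 k, ∀ a ∈ A, (a : Equiv.Perm (P1xP1 k)) x = x) ∧
      ∀ a ∈ A, PreservesRulings (a : Equiv.Perm (P1xP1 k)) := by
  let ι : G →* Equiv.Perm (P1xP1 k) := (P1xP1.Aut k).subtype.comp G.subtype
  have hι : Function.Injective ι := Subtype.val_injective.comp Subtype.val_injective
  let PP : Subgroup (Equiv.Perm (P1 k) × Equiv.Perm (P1 k)) := (P1.PL k).prod (P1.PL k)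
  let G' : Subgroup G := (PP.map (prodHom k)).comap ι
  let K : Subgroup (Equiv.Perm (P1 k) × Equiv.Perm (P1 k)) := PP ⊓ ι.range.comap (prodHom k)
  have hK : Finite K := by
    have : Set.Finite (prodHom k ⁻¹' (Set.range ι)) :=
      (Set.finite_range ι).preimage prodHom_injective.injOn
    exact this.subset fun x hx => hx.2
  let H₁ := K.map (MonoidHom.fst _ _)
  let H₂ := K.map (MonoidHom.snd _ _)
  have hH₁ : Finite H₁ :=
    Set.Finite.image _ (s := (K : Set (Equiv.Perm (P1 k) × Equiv.Perm (P1 k)))) hK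
  have hH₂ : Finite H₂ :=
    Set.Finite.image _ (s := (K : Set (Equiv.Perm (P1 k) × Equiv.Perm (P1 k)))) hK
  have hPL₁ : H₁ ≤ P1.PL k := by
    rintro _ ⟨x, hx, rfl⟩
    exact hx.1.1
  have hPL₂ : H₂ ≤ P1.PL k := by
    rintro _ ⟨x, hx, rfl⟩
    exact hx.1.2
  obtain ⟨p₁, hp₁, hcomm₁⟩ := P1.exists_point_of_finite H₁ hPL₁
  obtain ⟨p₂, hp₂, hcomm₂⟩ := P1.exists_point_of_finite H₂ hPL₂
  have hG' : ∀ a ∈ G', ∃ g ∈ H₁, ∃ h ∈ H₂, prodHom k (g, h) = ι a := by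
    rintro a ⟨x, hx, hxa⟩
    have hxK : x ∈ K := ⟨hx, a, hxa.symm⟩
    exact ⟨x.1, ⟨x, hxK, rfl⟩, x.2, ⟨x, hxK, rfl⟩, hxa⟩
  let x : P1xP1 k := (p₁, p₂)
  refine ⟨MulAction.stabilizer G x ⊓ G', ?_, ?_, ⟨x, fun a ha => ha.1⟩, ?_⟩
  · intro a ha b hb
    obtain ⟨g, hg, h, hh, e⟩ := hG' a ha.2
    obtain ⟨g', hg', h', hh', e'⟩ := hG' b hb.2
    have h1 : prodHom k (g, h) x = x := by rw [e]; exact ha.1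
    have h2 : prodHom k (g', h') x = x := by rw [e']; exact hb.1
    refine hι ?_
    rw [map_mul, map_mul, ← e, ← e', ← map_mul, ← map_mul, Prod.mk_mul_mk, Prod.mk_mul_mk,
      hcomm₁ g hg g' hg' (congrArg Prod.fst h1) (congrArg Prod.fst h2),
      hcomm₂ h hh h' hh' (congrArg Prod.snd h1) (congrArg Prod.snd h2)]
  · have hswap : ∀ a : G, a ∉ G' → ∃ y ∈ PP, ι a = prodHom k y * swapPerm := by
      intro a ha
      obtain ⟨g, hg, h, hh, e | e⟩ := exists_of_mem_aut a.1.2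
      · exact absurd ⟨(g, h), ⟨hg, hh⟩, Equiv.ext fun x => (e x).symm⟩ ha
      · exact ⟨(g, h), ⟨hg, hh⟩, Equiv.ext fun x => e x⟩
    have hindex : G'.index ≤ 2 := by
      refine G'.index_le_two_of_mul_mem fun a b ha hb => ?_
      obtain ⟨y, hy, e⟩ := hswap a ha
      obtain ⟨z, hz, e'⟩ := hswap b hb
      -- Moving the interchange past `z` swaps its components, and the two interchanges cancel.
      refine ⟨y * z.swap, PP.mul_mem hy ⟨hz.2, hz.1⟩, ?_⟩
      rw [map_mul, map_mul, e, e']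
      rfl
    have hrel : (MulAction.stabilizer G x ⊓ G').relIndex G' ≤ 144 := by
      rw [Subgroup.inf_relIndex_right, Subgroup.relIndex]
      have h1 : (MulAction.stabilizer G x).subgroupOf G' = MulAction.stabilizer G' x := rfl
      rw [h1, MulAction.index_stabilizer]
      -- The orbit lies in a product of two orbits of at most `12` points, whence `144`.
      have h2 : MulAction.orbit G' x ⊆ MulAction.orbit H₁ p₁ ×ˢ MulAction.orbit H₂ p₂ := by
        rintro _ ⟨a, rfl⟩
        obtain ⟨g, hg, h, hh, e⟩ := hG' a.1 a.2
        have h3 : ι a.1 x = (g p₁, h p₂) := by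
          rw [← e]
          rfl
        exact ⟨⟨⟨g, hg⟩, congrArg Prod.fst h3.symm⟩, ⟨⟨h, hh⟩, congrArg Prod.snd h3.symm⟩⟩
      have h3 := Set.ncard_le_ncard h2 ((Set.finite_range _).prod (Set.finite_range _))
      rw [Set.ncard_prod] at h3
      exact h3.trans (Nat.mul_le_mul hp₁ hp₂)
    rw [← Subgroup.relIndex_mul_index inf_le_right]
    exact Nat.mul_le_mul hrel hindex
  · intro a ha
    obtain ⟨g, -, h, -, e⟩ := hG' a ha.2
    have := preservesRulings_prodHom g h
    rwa [e] at this

theorem isWeakJordanBound_aut [IsAlgClosed k] [CharZero k] :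
    IsWeakJordanBound (P1xP1.Aut k) 288 := fun G hG => by
  obtain ⟨A, hA, hindex, -⟩ := exists_abelian_of_finite_aut G hG
  exact ⟨A, hA, hindex⟩

end P1xP1

/-! ### Abelian subgroups of the alternating group on five letters -/

section AlternatingGroup

open Equiv.Perm

/-- The parts are at least `2` with sum at most `5`, and the sum plus the number of parts is even.
-/
theorem cycleType_of_sign_eq_one {g : Equiv.Perm (Fin 5)} (hg : g ≠ 1)
    (hs : Equiv.Perm.sign g = 1) :
    g.cycleType = {3} ∨ g.cycleType = {2, 2} ∨ g.cycleType = {5} := by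
  have h1 := Equiv.Perm.sum_cycleType g
  have h2 : g.support.card ≤ 5 := g.support.card_le_univ
  have h3 := Equiv.Perm.sign_of_cycleType g
  have h4 : ∀ n ∈ g.cycleType, 2 ≤ n := fun n hn => two_le_of_mem_cycleType hn
  have h5 : g.cycleType ≠ 0 := fun h => hg (cycleType_eq_zero.mp h)
  rw [← h1] at h2
  rw [hs, eq_comm, neg_one_pow_eq_one_iff_even (by decide)] at h3
  generalize g.cycleType = m at h2 h3 h4 h5
  clear h1 hs hg
  obtain ⟨a, ha⟩ := Multiset.exists_mem_of_ne_zero h5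
  obtain ⟨t, rfl⟩ := Multiset.exists_cons_of_mem ha
  have ha2 := h4 a ha
  rcases Multiset.empty_or_exists_mem t with rfl | ⟨b, hb⟩
  · simp only [Multiset.sum_cons, Multiset.sum_zero, Multiset.card_cons, Multiset.card_zero] at h2 h3
    have h6 : a = 3 ∨ a = 5 := by
      rw [Nat.even_iff] at h3
      omega
    rcases h6 with rfl | rfl
    · exact .inl rfl
    · exact .inr (.inr rfl)
  · obtain ⟨t, rfl⟩ := Multiset.exists_cons_of_mem hb
    have hb2 := h4 b (Multiset.mem_cons_of_mem hb)
    rcases Multiset.empty_or_exists_mem t with rfl | ⟨c, hc⟩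
    · simp only [Multiset.sum_cons, Multiset.sum_zero, Multiset.card_cons,
        Multiset.card_zero] at h2 h3
      have h6 : a = 2 ∧ b = 2 := by
        rw [Nat.even_iff] at h3
        omega
      obtain ⟨rfl, rfl⟩ := h6
      exact .inr (.inl rfl)
    · obtain ⟨t, rfl⟩ := Multiset.exists_cons_of_mem hc
      have hc2 := h4 c (Multiset.mem_cons_of_mem (Multiset.mem_cons_of_mem hc))
      simp only [Multiset.sum_cons] at h2
      omega

-- An abelian subgroup lies in the centralizer of each of its elements, and centralizer orders
-- depend only on the conjugacy class. One representative of each nontrivial even cycle type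
-- therefore suffices, and these are enumerated.
set_option maxRecDepth 100000 in
theorem card_even_centralizer_le_five :
    ∀ g ∈ ({c[0, 1, 2], c[0, 1] * c[2, 3], c[0, 1, 2, 3, 4]} : Finset (Equiv.Perm (Fin 5))),
      (Finset.univ.filter fun h : Equiv.Perm (Fin 5) =>
        g * h = h * g ∧ Equiv.Perm.sign h = 1).card ≤ 5 := by
  decide +kernel

theorem exists_isConj_of_sign_eq_one {g : Equiv.Perm (Fin 5)} (hg : g ≠ 1)
    (hs : Equiv.Perm.sign g = 1) :
    ∃ g' ∈ ({c[0, 1, 2], c[0, 1] * c[2, 3], c[0, 1, 2, 3, 4]} : Finset (Equiv.Perm (Fin 5))),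
      IsConj g g' := by
  simp only [isConj_iff_cycleType_eq]
  rcases cycleType_of_sign_eq_one hg hs with h | h | h <;> rw [h]
  · exact ⟨c[0, 1, 2], by simp, by decide +kernel⟩
  · exact ⟨c[0, 1] * c[2, 3], by simp, by decide +kernel⟩
  · exact ⟨c[0, 1, 2, 3, 4], by simp, by decide +kernel⟩

/-- Abelian subgroups of the alternating group on five letters have at most five elements. -/
theorem card_le_five_of_comm (A : Subgroup (alternatingGroup (Fin 5)))
    (hA : ∀ a ∈ A, ∀ b ∈ A, a * b = b * a) : Nat.card A ≤ 5 := by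
  by_cases h : A = ⊥
  · simp [h]
  obtain ⟨g, hgA, hg⟩ := A.bot_or_exists_ne_one.resolve_left h
  obtain ⟨g', hg', hconj⟩ := exists_isConj_of_sign_eq_one (g := (g : Equiv.Perm (Fin 5)))
    (fun h => hg (Subtype.ext h)) g.2
  obtain ⟨c, rfl⟩ := isConj_iff.mp hconj
  refine le_trans ?_ (card_even_centralizer_le_five _ hg')
  rw [← Fintype.card_coe, ← Nat.card_eq_fintype_card]
  refine Nat.card_le_card_of_injective (fun h : A => ⟨c * h * c⁻¹, ?_⟩) fun h h' e => ?_
  · have h1 : (g : Equiv.Perm (Fin 5)) * h = h * g :=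
      congrArg Subtype.val (hA g hgA h h.2)
    have h2 : Equiv.Perm.sign (h : Equiv.Perm (Fin 5)) = 1 := h.1.2
    rw [Finset.mem_filter]
    refine ⟨Finset.mem_univ _, ?_, by simp [h2]⟩
    calc c * g * c⁻¹ * (c * h * c⁻¹) = c * (g * h) * c⁻¹ := by group
      _ = c * h * c⁻¹ * (c * g * c⁻¹) := by rw [h1]; group
  · have h1 := congrArg Subtype.val e
    exact Subtype.ext (Subtype.ext (mul_left_cancel (mul_right_cancel h1)))

end AlternatingGroup

/-! ### Abelian subgroups of the wreath product -/

section WreathProduct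

/-- Let `Γ` contain the wreath product of a group `S` of order `60` with the group of order two. If
abelian subgroups of `S` have order at most `5`, then a weak Jordan bound of `Γ` is at
least `288`. -/
theorem IsWeakJordanBound.le_of_wreath {Γ S : Type*} [Group Γ] [Group S] [Finite S]
    (hS : Nat.card S = 60)
    (hab : ∀ A : Subgroup S, (∀ a ∈ A, ∀ b ∈ A, a * b = b * a) → Nat.card A ≤ 5)
    (θ : S × S →* Γ) (hθ : Function.Injective θ) (τ : Γ) (hτ : τ * τ = 1)
    (hτθ : ∀ y, τ * θ y = θ y.swap * τ) (hτr : ∀ y, θ y ≠ τ) {J : ℕ} (hJ : IsWeakJordanBound Γ J) :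
    288 ≤ J := by
  -- Normal form of the elements of the wreath product; the Boolean records whether `τ` occurs.
  -- Injectivity gives the order `60 * 60 * 2 = 7200`.
  let f : (S × S) × Bool → Γ := fun y => if y.2 then θ y.1 * τ else θ y.1
  have hf : Function.Injective f := by
    rintro ⟨y, b⟩ ⟨z, c⟩ h
    cases b <;> cases c <;> simp only [f, Bool.false_eq_true, if_false, if_true] at h
    · rw [hθ h]
    · exact absurd (by rw [map_mul, map_inv, h, inv_mul_cancel_left]) (hτr (z⁻¹ * y))
    · exact absurd (by rw [map_mul, map_inv, ← h, inv_mul_cancel_left]) (hτr (y⁻¹ * z))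
    · rw [hθ (mul_right_cancel h)]
  have hτinv : τ⁻¹ = τ := inv_eq_of_mul_eq_one_left hτ
  let Γ₀ : Subgroup Γ :=
    { carrier := Set.range f
      one_mem' := ⟨(1, false), by simp [f]⟩
      mul_mem' := by
        rintro _ _ ⟨⟨y, b⟩, rfl⟩ ⟨⟨z, c⟩, rfl⟩
        cases b <;> cases c
        · exact ⟨(y * z, false), by simp [f]⟩
        · exact ⟨(y * z, true), by simp [f, mul_assoc]⟩
        · exact ⟨(y * z.swap, true), by simp [f, mul_assoc, hτθ]⟩
        · refine ⟨(y * z.swap, false), ?_⟩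
          simp only [f, Bool.false_eq_true, if_false, if_true, map_mul]
          rw [mul_assoc, ← mul_assoc τ, hτθ, mul_assoc _ τ, hτ, mul_one]
      inv_mem' := by
        rintro _ ⟨⟨y, b⟩, rfl⟩
        cases b
        · exact ⟨(y⁻¹, false), by simp [f]⟩
        · exact ⟨(y⁻¹.swap, true), by
            simp only [f, if_true, mul_inv_rev, hτinv, ← map_inv, hτθ]⟩ }
  have hcard : Nat.card Γ₀ = 7200 := by
    have h1 := Nat.card_congr (Equiv.ofInjective f hf)
    have h2 : Nat.card Γ₀ = Nat.card (Set.range f) := rfl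
    rw [h2, ← h1, Nat.card_prod, Nat.card_prod, hS]
    simp
  have hfin : Finite Γ₀ := Nat.finite_of_card_ne_zero (by rw [hcard]; norm_num)
  obtain ⟨A, hA, hAJ⟩ := hJ Γ₀ hfin
  refine le_trans ?_ hAJ
  let A' : Subgroup Γ := A.map Γ₀.subtype
  have hA' : ∀ a ∈ A', ∀ b ∈ A', a * b = b * a := by
    rintro _ ⟨a, ha, rfl⟩ _ ⟨b, hb, rfl⟩
    exact congrArg Subtype.val (hA a ha b hb)
  have hAf : ∀ a ∈ A', ∃ y, a = f y := by
    rintro _ ⟨a, -, rfl⟩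
    obtain ⟨y, hy⟩ := a.2
    exact ⟨y, hy.symm⟩
  have hcardA : Nat.card A' = Nat.card A :=
    (Nat.card_congr (A.equivMapOfInjective _ Γ₀.subtype_injective).toEquiv).symm
  let B : Subgroup (S × S) := A'.comap θ
  have hB : ∀ a ∈ B, ∀ b ∈ B, a * b = b * a := fun a ha b hb =>
    hθ (by rw [map_mul, map_mul, hA' _ ha _ hb])
  let B₁ := B.map (MonoidHom.fst S S)
  let B₂ := B.map (MonoidHom.snd S S)
  have hB₁ : Nat.card B₁ ≤ 5 := hab _ (by
    rintro _ ⟨a, ha, rfl⟩ _ ⟨b, hb, rfl⟩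
    exact congrArg Prod.fst (hB a ha b hb))
  have hB₂ : Nat.card B₂ ≤ 5 := hab _ (by
    rintro _ ⟨a, ha, rfl⟩ _ ⟨b, hb, rfl⟩
    exact congrArg Prod.snd (hB a ha b hb))
  have hA25 : Nat.card A' ≤ 25 := by
    by_cases hsub : ∃ c, θ c * τ ∈ A'
    · obtain ⟨c, hc⟩ := hsub
      -- Commuting with `θ c * τ` makes the second component a conjugate of the first, so `B` embeds
      -- into `B₁` and has order at most `5`. Since `A'` is covered by two translates of the image
      -- of `B`, it has at most `10` elements.
      have hconj : ∀ y ∈ B, y.2 = c.1⁻¹ * y.1 * c.1 := by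
        intro y hy
        have h1 := hA' _ hc _ hy
        rw [mul_assoc, hτθ, ← mul_assoc, ← mul_assoc, ← map_mul, ← map_mul] at h1
        have h2 := congrArg Prod.fst (hθ (mul_right_cancel h1))
        simp only [Prod.fst_mul, Prod.fst_swap] at h2
        rw [mul_assoc, ← h2, inv_mul_cancel_left]
      have hBcard : Nat.card B ≤ 5 := by
        refine le_trans (Nat.card_le_card_of_injective
          (fun y : B => (⟨y.1.1, y.1, y.2, rfl⟩ : B₁)) fun y z h => ?_) hB₁
        have h1 : y.1.1 = z.1.1 := congrArg Subtype.val h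
        exact Subtype.ext (Prod.ext h1 (by rw [hconj _ y.2, hconj _ z.2, h1]))
      have hcover : (A' : Set Γ) ⊆ θ '' B ∪ (fun x => x * (θ c * τ)) '' (θ '' B) := by
        intro a ha
        obtain ⟨⟨y, b⟩, rfl⟩ := hAf a ha
        cases b
        · exact .inl ⟨y, by simpa [B, f] using ha, by simp [f]⟩
        · right
          have h1 : θ (y * c⁻¹) * (θ c * τ) = f (y, true) := by
            simp [f, map_mul, mul_assoc]
          refine ⟨_, ⟨y * c⁻¹, ?_, rfl⟩, h1⟩
          have h2 : θ (y * c⁻¹) = f (y, true) * (θ c * τ)⁻¹ := by rw [← h1, mul_inv_cancel_right]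
          change θ (y * c⁻¹) ∈ A'
          rw [h2]
          exact A'.mul_mem ha (A'.inv_mem hc)
      have h1 := Set.ncard_le_ncard hcover
        (((Set.toFinite _).image _).union (((Set.toFinite _).image _).image _))
      have h2 := Set.ncard_union_le (θ '' B) ((fun x => x * (θ c * τ)) '' (θ '' B))
      have h3 : (θ '' (B : Set (S × S))).ncard ≤ Nat.card B := Set.ncard_image_le (Set.toFinite _)
      have h4 : ((fun x => x * (θ c * τ)) '' (θ '' (B : Set (S × S)))).ncard ≤
          (θ '' (B : Set (S × S))).ncard := Set.ncard_image_le ((Set.toFinite _).image _)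
      have h5 : Nat.card A' = (A' : Set Γ).ncard := rfl
      omega
    · push Not at hsub
      -- Without elements involving `τ`, the group sits in the product of its two abelian
      -- projections: the bound is `5 * 5`.
      have hcover : (A' : Set Γ) ⊆ θ '' ((B₁ : Set S) ×ˢ (B₂ : Set S)) := by
        intro a ha
        obtain ⟨⟨y, b⟩, rfl⟩ := hAf a ha
        cases b
        · have hy : y ∈ B := by simpa [B, f] using ha
          exact ⟨y, ⟨⟨y, hy, rfl⟩, ⟨y, hy, rfl⟩⟩, by simp [f]⟩
        · exact absurd (by simpa [f] using ha) (hsub y)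
      have h1 := Set.ncard_le_ncard hcover ((Set.toFinite _).image _)
      have h2 : (θ '' ((B₁ : Set S) ×ˢ (B₂ : Set S))).ncard ≤ _ :=
        Set.ncard_image_le (Set.toFinite _)
      rw [Set.ncard_prod] at h2
      have h3 : (A' : Set Γ).ncard ≤ Nat.card B₁ * Nat.card B₂ := h1.trans h2
      exact h3.trans (Nat.mul_le_mul hB₁ hB₂)
  have hmul := A.card_mul_index
  rw [hcard, ← hcardA] at hmul
  nlinarith

end WreathProduct

/-! ### The icosahedral group from a regular simplex of matrices -/

namespace P1

open Matrix

variable {k : Type*} [Field k]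

/-- The linear automorphism of the plane attached to an invertible matrix. -/
noncomputable def matrixEquiv : GL (Fin 2) k →* ((Fin 2 → k) ≃ₗ[k] (Fin 2 → k)) :=
  (LinearMap.GeneralLinearGroup.generalLinearEquiv k (Fin 2 → k)).toMonoidHom.comp
    Matrix.GeneralLinearGroup.toLin.toMonoidHom

theorem matrixEquiv_apply (a : GL (Fin 2) k) (v : Fin 2 → k) :
    matrixEquiv a v = (a : Matrix (Fin 2) (Fin 2) k) *ᵥ v := rfl

/-- The projective linear transformation attached to an invertible matrix. -/
noncomputable def mobius : GL (Fin 2) k →* Equiv.Perm (P1 k) :=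
  (MulAction.toPermHom ((Fin 2 → k) ≃ₗ[k] (Fin 2 → k)) (P1 k)).comp matrixEquiv

theorem mobius_mem_PL (a : GL (Fin 2) k) : mobius a ∈ PL k := ⟨matrixEquiv a, rfl⟩

theorem mobius_eq_one_iff {a : GL (Fin 2) k} :
    mobius a = 1 ↔ ∃ c : k, (a : Matrix (Fin 2) (Fin 2) k) = c • (1 : Matrix (Fin 2) (Fin 2) k) := by
  constructor
  · intro h
    obtain ⟨c, hc⟩ := exists_eq_smul_of_forall_smul_eq (L := matrixEquiv a)
      fun p => congrArg (fun σ : Equiv.Perm (P1 k) => σ p) h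
    refine ⟨c, Matrix.ext_of_mulVec_single fun i => ?_⟩
    rw [← matrixEquiv_apply, hc, Matrix.smul_mulVec, Matrix.one_mulVec]
  · rintro ⟨c, hc⟩
    refine toPerm_eq_one_of_forall (a := c) fun w => ?_
    rw [matrixEquiv_apply, hc, Matrix.smul_mulVec, Matrix.one_mulVec]

theorem adjugate_sub_fin_two (x y : Matrix (Fin 2) (Fin 2) k) :
    (x - y).adjugate = x.adjugate - y.adjugate := by
  simp only [adjugate_fin_two]
  ext i j
  fin_cases i <;> fin_cases j <;> simp <;> ring

theorem adjugate_adjugate_fin_two (x : Matrix (Fin 2) (Fin 2) k) : x.adjugate.adjugate = x := by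
  simp only [adjugate_fin_two]
  ext i j
  fin_cases i <;> fin_cases j <;> simp

theorem adjugate_smul_fin_two (c : k) (x : Matrix (Fin 2) (Fin 2) k) :
    (c • x).adjugate = c • x.adjugate := by
  simp [adjugate_smul]

/-- Both sides are the polarization of the determinant, because `x.adjugate * x = x * x.adjugate` is
the scalar `x.det`. -/
theorem adjugate_mul_add_adjugate_mul_fin_two (x y : Matrix (Fin 2) (Fin 2) k) :
    x.adjugate * y + y.adjugate * x = x * y.adjugate + y * x.adjugate := by
  rw [eta_fin_two x, eta_fin_two y]
  simp only [adjugate_fin_two_of, mul_fin_two]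
  ext i j
  fin_cases i <;> fin_cases j <;> simp <;> ring

/-- The matrices `vertex (z ^ j)`, for `z` a primitive fifth root of unity, are the vertices of a
regular simplex for the determinant form. -/
def vertex (t : k) : Matrix (Fin 2) (Fin 2) k := !![t, t ^ 2; t ^ 3, -t ^ 4]

theorem det_vertex {t : k} (ht : t ^ 5 = 1) : (vertex t).det = -2 := by
  rw [vertex, det_fin_two_of]
  linear_combination (-2) * ht

/-- The polar form of the determinant is `1` on distinct vertices and `2 * (-2) = -4` on equal ones,
the Gram matrix of a regular simplex with five vertices in dimension four. -/
theorem vertex_mul_adjugate_add {s t : k} (hs : s ^ 5 = 1) (ht : t ^ 5 = 1) (hne : s ≠ t) :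
    vertex s * (vertex t).adjugate + vertex t * (vertex s).adjugate = 1 := by
  have h : s ^ 4 + s ^ 3 * t + s ^ 2 * t ^ 2 + s * t ^ 3 + t ^ 4 = 0 := by
    have : (s - t) * (s ^ 4 + s ^ 3 * t + s ^ 2 * t ^ 2 + s * t ^ 3 + t ^ 4) = 0 := by
      linear_combination hs - ht
    exact (mul_eq_zero.mp this).resolve_left (sub_ne_zero.mpr hne)
  simp only [adjugate_fin_two, vertex]
  ext i j
  fin_cases i <;> fin_cases j <;> simp
  · linear_combination (-t) * h + ht
  · ring
  · ring
  · linear_combination (-t) * h + ht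

/-- The reflection that interchanges two vertices of the simplex. -/
theorem sub_mul_adjugate_mul_sub {ι : Type*} [DecidableEq ι] {t : ι → k}
    (ht5 : ∀ i, t i ^ 5 = 1) (ht : Function.Injective t) {i j : ι} (hij : i ≠ j) (l : ι) :
    (vertex (t i) - vertex (t j)) * (vertex (t l)).adjugate * (vertex (t i) - vertex (t j)) =
      (5 : k) • vertex (t (Equiv.swap i j l)) := by
  -- With `B` the polar form of the determinant, `r * x.adjugate * r = B(x, r) • r - r.det • x`,
  -- which is `-r.det` times the reflection of `x` in `r`. For a difference of vertices the
  -- determinant is `-5`, hence the factor `5`.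
  have hB : ∀ i j, i ≠ j →
      vertex (t i) * (vertex (t j)).adjugate + vertex (t j) * (vertex (t i)).adjugate = 1 :=
    fun i j hij => vertex_mul_adjugate_add (ht5 i) (ht5 j) (ht.ne hij)
  have hN : ∀ i, vertex (t i) * (vertex (t i)).adjugate = (-2 : k) • 1 := fun i => by
    rw [mul_adjugate, det_vertex (ht5 i)]
  have hN' : ∀ i, (vertex (t i)).adjugate * vertex (t i) = (-2 : k) • 1 := fun i => by
    rw [adjugate_mul, det_vertex (ht5 i)]
  have h1 : ∀ i l, vertex (t i) * (vertex (t i)).adjugate * vertex (t l) =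
      (-2 : k) • vertex (t l) := fun i l => by rw [hN, smul_mul_assoc, one_mul]
  have h2 : ∀ i l, vertex (t l) * (vertex (t i)).adjugate * vertex (t i) =
      (-2 : k) • vertex (t l) := fun i l => by rw [mul_assoc, hN', mul_smul_comm, mul_one]
  have h3 : ∀ i l, i ≠ l → vertex (t i) * (vertex (t l)).adjugate * vertex (t i) =
      vertex (t i) + (2 : k) • vertex (t l) := fun i l hil => by
    rw [eq_sub_of_add_eq (hB i l hil), sub_mul, one_mul, h2]
    module
  have h4 : ∀ l, i ≠ l → j ≠ l → vertex (t i) * (vertex (t l)).adjugate * vertex (t j) +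
      vertex (t j) * (vertex (t l)).adjugate * vertex (t i) =
      vertex (t i) + vertex (t j) - vertex (t l) := fun l hil hjl => by
    have h5 := adjugate_mul_add_adjugate_mul_fin_two (vertex (t i)) (vertex (t j))
    rw [hB i j hij] at h5
    rw [eq_sub_of_add_eq (hB i l hil), eq_sub_of_add_eq (hB j l hjl), sub_mul, sub_mul, one_mul,
      one_mul, mul_assoc, mul_assoc, ← add_sub_add_comm, ← mul_add, h5, mul_one, add_comm]
  have hexp : ∀ l, (vertex (t i) - vertex (t j)) * (vertex (t l)).adjugate *
      (vertex (t i) - vertex (t j)) =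
      vertex (t i) * (vertex (t l)).adjugate * vertex (t i) +
      vertex (t j) * (vertex (t l)).adjugate * vertex (t j) -
      (vertex (t i) * (vertex (t l)).adjugate * vertex (t j) +
      vertex (t j) * (vertex (t l)).adjugate * vertex (t i)) := fun l => by noncomm_ring
  rw [hexp]
  by_cases hil : i = l
  · subst hil
    rw [Equiv.swap_apply_left, h1, h3 j i hij.symm, h1, h2]
    module
  by_cases hjl : j = l
  · subst hjl
    rw [Equiv.swap_apply_right, h1, h3 i j hij, h1, h2]
    module
  · rw [Equiv.swap_apply_of_ne_of_ne (Ne.symm hil) (Ne.symm hjl), h3 i l hil, h3 j l hjl,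
      h4 l hil hjl]
    module

theorem det_vertex_sub {s t : k} (hs : s ^ 5 = 1) (ht : t ^ 5 = 1) (hne : s ≠ t) :
    (vertex s - vertex t).det = -5 := by
  have h := vertex_mul_adjugate_add hs ht hne
  have h1 : (vertex s - vertex t) * (vertex s - vertex t).adjugate = (-5 : k) • 1 := by
    rw [adjugate_sub_fin_two, mul_sub, sub_mul, sub_mul, mul_adjugate, mul_adjugate, det_vertex hs,
      det_vertex ht, eq_sub_of_add_eq h]
    module
  rw [mul_adjugate] at h1
  simpa using congrFun (congrFun h1 0) 0

/-- Multiplication by invertible matrices on both sides that fixes all vertices of the simplex is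
trivial up to scalars. -/
theorem exists_eq_smul_one_of_fixes_vertices {t : Fin 5 → k} (ht : Function.Injective t)
    {a b : Matrix (Fin 2) (Fin 2) k} (h : ∀ j, a * vertex (t j) * b = vertex (t j)) :
    ∃ c : k, a = c • (1 : Matrix (Fin 2) (Fin 2) k) := by
  -- A polynomial of degree at most `4` with five distinct roots is zero. The coefficients of `t`
  -- and `t ^ 3` in the entries `(0, 0)` and `(1, 0)` already force `a` to be scalar.
  have key : ∀ c₁ c₂ c₃ c₄ : k,
      (∀ j, c₁ * t j + c₂ * t j ^ 2 + c₃ * t j ^ 3 + c₄ * t j ^ 4 = 0) → c₁ = 0 ∧ c₃ = 0 := by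
    intro c₁ c₂ c₃ c₄ hc
    let P : Polynomial k := .C c₁ * .X + .C c₂ * .X ^ 2 + .C c₃ * .X ^ 3 + .C c₄ * .X ^ 4
    have hP : P = 0 := by
      refine Polynomial.eq_zero_of_natDegree_lt_card_of_eval_eq_zero P ht
        (fun j => by simpa [P] using hc j) ?_
      have : P.natDegree ≤ 4 := by
        simp only [P]
        compute_degree
      simpa using Nat.lt_succ_of_le this
    constructor
    · simpa [P, Polynomial.coeff_X, Polynomial.coeff_X_pow] using
        congrArg (fun Q => Polynomial.coeff Q 1) hP
    · simpa [P, Polynomial.coeff_X, Polynomial.coeff_X_pow] using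
        congrArg (fun Q => Polynomial.coeff Q 3) hP
  have hent : ∀ p q j, (a p 0 * b 0 q) * t j + (a p 0 * b 1 q) * t j ^ 2 +
      (a p 1 * b 0 q) * t j ^ 3 + (-(a p 1 * b 1 q)) * t j ^ 4 = vertex (t j) p q := by
    intro p q j
    rw [← h j]
    simp only [vertex, Matrix.mul_apply, Fin.sum_univ_two]
    simp
    ring
  have h00 := key (a 0 0 * b 0 0 - 1) (a 0 0 * b 1 0) (a 0 1 * b 0 0) (-(a 0 1 * b 1 0)) fun j => by
    have := hent 0 0 j
    simp [vertex] at this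
    linear_combination this
  have h10 := key (a 1 0 * b 0 0) (a 1 0 * b 1 0) (a 1 1 * b 0 0 - 1) (-(a 1 1 * b 1 0)) fun j => by
    have := hent 1 0 j
    simp [vertex] at this
    linear_combination this
  have h1 : a 0 0 * b 0 0 = 1 := sub_eq_zero.mp h00.1
  have h2 : a 1 1 * b 0 0 = 1 := sub_eq_zero.mp h10.2
  have hb : b 0 0 ≠ 0 := right_ne_zero_of_mul_eq_one h1
  have h3 : a 0 1 = 0 := (mul_eq_zero.mp h00.2).resolve_right hb
  have h4 : a 1 0 = 0 := (mul_eq_zero.mp h10.1).resolve_right hb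
  have h5 : a 1 1 = a 0 0 := mul_right_cancel₀ hb (h2.trans h1.symm)
  refine ⟨a 0 0, ?_⟩
  ext i j
  fin_cases i <;> fin_cases j <;> simp [h3, h4, h5]

/-- Pairs of a permutation of the vertices of the simplex and a projective linear transformation, the
left factor of a similarity of the space of matrices that induces this permutation. -/
def simplexGroup (t : Fin 5 → k) : Subgroup (Equiv.Perm (Fin 5) × Equiv.Perm (P1 k)) where
  carrier := {x | ∃ a b : GL (Fin 2) k, mobius a = x.2 ∧
    ∀ j, (a : Matrix (Fin 2) (Fin 2) k) * vertex (t j) * b = vertex (t (x.1 j))}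
  one_mem' := ⟨1, 1, map_one _, fun j => by simp⟩
  mul_mem' := by
    rintro x y ⟨a, b, h, hab⟩ ⟨a', b', h', hab'⟩
    refine ⟨a * a', b' * b, by rw [map_mul, h, h']; rfl, fun j => ?_⟩
    rw [Prod.fst_mul, Equiv.Perm.mul_apply, ← hab, ← hab', Units.val_mul, Units.val_mul]
    simp only [mul_assoc]
  inv_mem' := by
    rintro x ⟨a, b, h, hab⟩
    refine ⟨a⁻¹, b⁻¹, by rw [map_inv, h]; rfl, fun j => ?_⟩
    have h1 := hab (x⁻¹.1 j)
    rw [show x.1 (x⁻¹.1 j) = j from x.1.apply_symm_apply j] at h1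
    rw [← h1, ← mul_assoc, ← mul_assoc, Units.inv_mul, one_mul, mul_assoc, Units.mul_inv, mul_one]

theorem eq_one_of_mem_simplexGroup {t : Fin 5 → k} (ht : Function.Injective t)
    {g : Equiv.Perm (P1 k)} (h : (1, g) ∈ simplexGroup t) : g = 1 := by
  obtain ⟨a, b, rfl, hab⟩ := h
  exact mobius_eq_one_iff.mpr (exists_eq_smul_one_of_fixes_vertices ht hab)

/-- Thus the left factor is a function of the permutation, and this function is automatically
multiplicative. -/
theorem eq_of_mem_simplexGroup {t : Fin 5 → k} (ht : Function.Injective t)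
    {σ : Equiv.Perm (Fin 5)} {g h : Equiv.Perm (P1 k)} (hg : (σ, g) ∈ simplexGroup t)
    (hh : (σ, h) ∈ simplexGroup t) : g = h := by
  have := (simplexGroup t).mul_mem hg ((simplexGroup t).inv_mem hh)
  rw [Prod.inv_mk, Prod.mk_mul_mk, mul_inv_cancel] at this
  exact mul_inv_eq_one.mp (eq_one_of_mem_simplexGroup ht this)

/-- The product of two transpositions of the vertices is induced by a similarity. -/
theorem swap_mul_swap_mem_simplexGroup [CharZero k] {t : Fin 5 → k} (ht5 : ∀ j, t j ^ 5 = 1)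
    (ht : Function.Injective t) {i j p q : Fin 5} (hij : i ≠ j) (hpq : p ≠ q) :
    ∃ a : GL (Fin 2) k,
      (a : Matrix (Fin 2) (Fin 2) k) =
        (vertex (t i) - vertex (t j)) * (vertex (t p) - vertex (t q)).adjugate ∧
      (Equiv.swap i j * Equiv.swap p q, mobius a) ∈ simplexGroup t := by
  set r := vertex (t i) - vertex (t j)
  set s := vertex (t p) - vertex (t q)
  have hr : r.det = -5 := det_vertex_sub (ht5 i) (ht5 j) (ht.ne hij)
  have hs : s.det = -5 := det_vertex_sub (ht5 p) (ht5 q) (ht.ne hpq)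
  have hrs : (r * s.adjugate).det ≠ 0 := by
    rw [det_mul, det_adjugate, hr, hs]
    norm_num
  have hsr : ((25 : k)⁻¹ • (s.adjugate * r)).det ≠ 0 := by
    rw [det_smul, det_mul, det_adjugate, hr, hs]
    norm_num
  refine ⟨GeneralLinearGroup.mkOfDetNeZero _ hrs, rfl, GeneralLinearGroup.mkOfDetNeZero _ hrs,
    GeneralLinearGroup.mkOfDetNeZero _ hsr, rfl, fun l => ?_⟩
  -- Each reflection involves an adjugate. Taking the adjugate of the formula for `s` lets the two
  -- compose into left and right multiplications; the two factors `5` account for `25⁻¹`.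
  have h1 := congrArg adjugate (sub_mul_adjugate_mul_sub ht5 ht hpq l)
  rw [adjugate_mul_distrib, adjugate_mul_distrib, adjugate_adjugate_fin_two,
    adjugate_smul_fin_two] at h1
  have h2 := sub_mul_adjugate_mul_sub ht5 ht hij (Equiv.swap p q l)
  change r * s.adjugate * vertex (t l) * ((25 : k)⁻¹ • (s.adjugate * r)) = _
  calc r * s.adjugate * vertex (t l) * ((25 : k)⁻¹ • (s.adjugate * r))
      = (25 : k)⁻¹ • (r * (s.adjugate * (vertex (t l) * s.adjugate)) * r) := by
        rw [mul_smul_comm]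
        simp only [mul_assoc]
    _ = (25 : k)⁻¹ • (5 : k) • (5 : k) • vertex (t (Equiv.swap i j (Equiv.swap p q l))) := by
        rw [h1, mul_smul_comm, smul_mul_assoc, h2]
    _ = vertex (t ((Equiv.swap i j * Equiv.swap p q) l)) := by
        rw [smul_smul, smul_smul, Equiv.Perm.mul_apply]
        norm_num

/-- An even permutation is a product of an even number of transpositions, which can be taken two at
a time. -/
theorem exists_mem_simplexGroup [CharZero k] {t : Fin 5 → k} (ht5 : ∀ j, t j ^ 5 = 1)
    (ht : Function.Injective t) {σ : Equiv.Perm (Fin 5)} (hσ : σ ∈ alternatingGroup (Fin 5)) :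
    ∃ g, (σ, g) ∈ simplexGroup t := by
  suffices hind : ∀ (n : ℕ) (l : List (Equiv.Perm (Fin 5))) (_ : ∀ g, g ∈ l → g.IsSwap)
      (_ : l.length = 2 * n), ∃ g, (l.prod, g) ∈ simplexGroup t by
    obtain ⟨l, rfl, hl⟩ := Equiv.Perm.truncSwapFactors σ
    obtain ⟨n, hn⟩ := (Equiv.Perm.prod_list_swap_mem_alternatingGroup_iff_even_length hl).1 hσ
    rw [← two_mul] at hn
    exact hind n l hl hn
  intro n
  induction n with intro l hl hn
  | zero => exact ⟨1, by rw [List.length_eq_zero_iff.1 hn]; exact (simplexGroup t).one_mem⟩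
  | succ n ih =>
    rw [Nat.mul_succ] at hn
    obtain ⟨a, l, rfl⟩ := l.exists_of_length_succ hn
    rw [List.length_cons, Nat.succ_inj] at hn
    obtain ⟨b, l, rfl⟩ := l.exists_of_length_succ hn
    rw [List.length_cons, Nat.succ_inj] at hn
    obtain ⟨i, j, hij, rfl⟩ := hl a (by simp)
    obtain ⟨p, q, hpq, rfl⟩ := hl b (by simp)
    obtain ⟨c, -, hc⟩ := swap_mul_swap_mem_simplexGroup ht5 ht hij hpq
    obtain ⟨g, hg⟩ := ih l (fun x hx => hl x (by simp [hx])) hn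
    refine ⟨mobius c * g, ?_⟩
    rw [List.prod_cons, List.prod_cons, ← mul_assoc]
    exact (simplexGroup t).mul_mem hc hg

/-- The icosahedral group: the alternating group on five letters embeds into the group of projective
linear transformations. -/
theorem exists_alternatingGroup_hom [IsAlgClosed k] [CharZero k] :
    ∃ ρ : alternatingGroup (Fin 5) →* Equiv.Perm (P1 k), Function.Injective ρ ∧
      ∀ σ, ρ σ ∈ PL k := by
  have : NeZero ((5 : ℕ) : k) := ⟨by norm_num⟩
  obtain ⟨z, hz⟩ := HasEnoughRootsOfUnity.exists_primitiveRoot k 5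
  let t : Fin 5 → k := fun j => z ^ (j : ℕ)
  have ht5 : ∀ j, t j ^ 5 = 1 := fun j => by
    rw [← pow_mul, mul_comm, pow_mul, hz.pow_eq_one, one_pow]
  have ht : Function.Injective t := fun i j h => Fin.ext (hz.pow_inj i.2 j.2 h)
  choose f hf using fun σ : alternatingGroup (Fin 5) => exists_mem_simplexGroup ht5 ht σ.2
  let ρ : alternatingGroup (Fin 5) →* Equiv.Perm (P1 k) := MonoidHom.mk' f fun σ τ =>
    eq_of_mem_simplexGroup ht (hf (σ * τ)) ((simplexGroup t).mul_mem (hf σ) (hf τ))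
  refine ⟨ρ, ?_, fun σ => ?_⟩
  · rw [← MonoidHom.ker_eq_bot_iff]
    have : IsSimpleGroup (alternatingGroup (Fin 5)) := alternatingGroup.isSimpleGroup (by simp)
    -- By simplicity it suffices that one element, a product of two transpositions sharing a letter,
    -- acts nontrivially.
    refine (inferInstance : ρ.ker.Normal).eq_bot_or_eq_top.resolve_right fun htop => ?_
    obtain ⟨a, ha, hmem⟩ := swap_mul_swap_mem_simplexGroup ht5 ht (i := 0) (j := 1) (p := 1) (q := 2)
      (by decide) (by decide)
    let σ : alternatingGroup (Fin 5) := ⟨Equiv.swap 0 1 * Equiv.swap 1 2,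
      Equiv.Perm.mem_alternatingGroup.mpr (by decide)⟩
    have h1 : ρ σ = 1 := by
      rw [← MonoidHom.mem_ker, htop]
      trivial
    have h2 : mobius a = 1 := (eq_of_mem_simplexGroup ht hmem (hf σ)).trans h1
    obtain ⟨c, hc⟩ := mobius_eq_one_iff.mp h2
    rw [ha] at hc
    -- Otherwise the differences `vertex 1 - vertex z` and `vertex z - vertex (z ^ 2)` would be
    -- proportional. Their entries `(0, 0)` and `(0, 1)` have ratios `z` and `z ^ 2`, which differ.
    have h3 := congrArg (fun x => x * (vertex (t 1) - vertex (t 2))) hc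
    simp only [mul_assoc, adjugate_mul, smul_mul_assoc, one_mul, mul_smul_comm, mul_one,
      det_vertex_sub (ht5 1) (ht5 2) (ht.ne (by decide))] at h3
    have hz1 : z ≠ 1 := hz.ne_one (by norm_num)
    have hz2 : z ^ 2 ≠ 1 := fun h => absurd (hz.dvd_of_pow_eq_one 2 h) (by norm_num)
    have h4 := congrFun (congrFun h3 0) 0
    have h5 := congrFun (congrFun h3 0) 1
    simp [vertex, t] at h4 h5
    have h6 : c * z = -5 := by
      refine mul_left_cancel₀ (sub_ne_zero.mpr hz1) ?_
      linear_combination h4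
    have h7 : c * z ^ 2 = -5 := by
      refine mul_left_cancel₀ (sub_ne_zero.mpr hz2) ?_
      linear_combination h5
    have h8 : (5 : k) * (z - 1) = 0 := by linear_combination z * h6 - h7
    exact (mul_ne_zero (by norm_num) (sub_ne_zero.mpr hz1)) h8
  · obtain ⟨a, b, h, -⟩ := hf σ
    change f σ ∈ PL k
    rw [← show mobius a = f σ from h]
    exact mobius_mem_PL a

end P1

/-! ### The lower bound and the theorem -/

namespace P1xP1

variable {k : Type*} [Field k]

theorem le_of_isWeakJordanBound_aut [IsAlgClosed k] [CharZero k] {J : ℕ}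
    (hJ : IsWeakJordanBound (P1xP1.Aut k) J) : 288 ≤ J := by
  obtain ⟨ρ, hρ, hPL⟩ := P1.exists_alternatingGroup_hom (k := k)
  let θ : alternatingGroup (Fin 5) × alternatingGroup (Fin 5) →* P1xP1.Aut k :=
    ((prodHom k).comp (ρ.prodMap ρ)).codRestrict (P1xP1.Aut k) fun y =>
      prodCongr_mem_aut (hPL y.1) (hPL y.2)
  have hθ : Function.Injective θ := fun y z h =>
    (hρ.prodMap hρ) (prodHom_injective (congrArg Subtype.val h))
  refine hJ.le_of_wreath (S := alternatingGroup (Fin 5)) ?_ card_le_five_of_comm θ hθ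
    ⟨swapPerm, swapPerm_mem_aut⟩ rfl (fun y => rfl) fun y hy => ?_
  · rw [nat_card_alternatingGroup, Nat.card_eq_fintype_card, Fintype.card_fin]
    rfl
  -- A product map sends `(p, p)` and `(p, q)` to points with the same first coordinate; the
  -- interchange does not.
  · have h : ∀ x, prodHom k (ρ y.1, ρ y.2) x = swapPerm x := fun x =>
      congrArg (fun σ : P1xP1.Aut k => (σ : Equiv.Perm (P1xP1 k)) x) hy
    let p : P1 k := Projectivization.mk k ![0, 1] P1.vec_zero_one_ne_zero
    let q : P1 k := Projectivization.mk k ![1, 0] P1.vec_one_zero_ne_zero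
    have hpq : p ≠ q := by
      rw [Ne, P1.mk_eq_mk_iff_mul]
      simp
    exact hpq ((congrArg Prod.fst (h (p, p))).symm.trans (congrArg Prod.fst (h (p, q))))

end P1xP1

theorem lemma2p6 (k : Type*) [Field k] [IsAlgClosed k] [CharZero k] :
    (∀ G : Subgroup (P1.Aut k), Finite G →
      ∃ A : Subgroup G, (∀ a ∈ A, ∀ b ∈ A, a * b = b * a) ∧ A.index ≤ 12 ∧
        ∃ p : P1 k, ∀ a ∈ A, (a : Equiv.Perm (P1 k)) p = p) ∧
    (∀ G : Subgroup (P1xP1.Aut k), Finite G →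
      ∃ A : Subgroup G, (∀ a ∈ A, ∀ b ∈ A, a * b = b * a) ∧ A.index ≤ 288 ∧
        (∃ x : P1xP1 k, ∀ a ∈ A, (a : Equiv.Perm (P1xP1 k)) x = x) ∧
        ∀ a ∈ A, P1xP1.PreservesRulings (a : Equiv.Perm (P1xP1 k))) ∧
    HasWeakJordanConstant (P1xP1.Aut k) 288 :=
  ⟨P1.exists_abelian_of_finite_aut, P1xP1.exists_abelian_of_finite_aut,
    ⟨_, P1xP1.isWeakJordanBound_aut.isJordanBound⟩, P1xP1.isWeakJordanBound_aut,
    fun _ hJ => P1xP1.le_of_isWeakJordanBound_aut hJ⟩
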